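/- Let $(R,*)$ be a ring with identity together with an involution (an anti-automorphism with $r^{**}=r$; it may be trivial if $R$ is commutative), let $n\ge 0$, and let $A={\rm M}(n,R)$ carry the $*$-transpose involution $(a_{ij})^*=(a_{ji}^*)$. Write $A^{\rm sym}=\{b\in A: b^*=b\}$ and $J=\begin{pmatrix}0&1\\-1&0\end{pmatrix}$. Let ${\rm GL}_*(2,A)$ be the group of invertible $g\in{\rm M}(2,A)$ such that $g^*Jg=\delta(g)J$ for some central, invertible, symmetric $\delta(g)\in A$, and let ${\rm SL}_*(2,A)$ be the kernel of the homomorphism $\det_*$ on ${\rm GL}_*(2,A)$, $\det_*\begin{pmatrix}a&b\\c&d\end{pmatrix}=ad^*-bc^*$. The Bruhat elements are $$h_a=\begin{pmatrix}a^*&0\\0&a^{-1}\end{pmatrix}\ (a\in A^\times),\qquad u_b=\begin{pmatrix}1&b\\0&1\end{pmatrix}\ (b\in A^{\rm sym}),\qquad \omega=\begin{pmatrix}0&1\\-1&0\end{pmatrix}.$$ Then ${\rm SL}_*(2,A)$ is generated by the Bruhat elements (that is, the subgroup of ${\rm GL}(2,A)$ generated by the Bruhat elements is exactly ${\rm SL}_*(2,A)$)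 in each of the following cases: (i) $R$ is a $*$-local ring, i.e. every maximal left ideal of $R$ is a two-sided ideal, and among the proper two-sided ideals $I$ of $R$ with $I^*=I$ there is a unique maximal one; (ii) $R=\mathbb{A}_F$ is the ring of adèles of a global field $F$ (a number field, or a finite extension of $\mathbb{F}_p(t)$ for a prime $p$), with the trivial involution; (iii) $R=\mathbb{A}_E$ is the ring of adèles of $E$, where $E/F$ is a separable quadratic extension of a global field $F$, with the involution induced by the non-trivial element $\sigma$ of ${\rm Gal}(E/F)$: the component of $x^*$ at a place $w$ of $E$ is the image of $x_{w\circ\sigma}$ under the continuous extension $E_{w\circ\sigma}\to E_w$ of $\sigma$; (iv) $R=\mathbb{A}_{\mathbb{H}}=\mathbb{H}\otimes_F\mathbb{A}_F$, where $F$ is a global field of characteristic $2$ and $\mathbb{H}$ is a quaternion algebra over $F$ (division or split), with the involution $(h\otimes x)^*=\bar h\otimes x$, where $h\mapsto\bar h$ is quaternion conjugation. Here the ring of adèles of a global field is the restricted product of its completions at all places with respect to the rings of integers at the non-archimedean places. -/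

import Mathlib

namespace StarBruhat

open scoped Matrix RestrictedProduct TensorProduct

/-! ### The groups `GL_*(2, A)` and `SL_*(2, A)` and the Bruhat elements -/

section SLStar

variable (A : Type*) [Ring A]

/-- The matrix `J = (0 1; -1 0)`. -/
def J : Matrix (Fin 2) (Fin 2) A := !![0, 1; -1, 0]

lemma J_mul_J : J A * J A = -1 := by
  ext i j
  fin_cases i <;> fin_cases j <;> simp [J, Matrix.mul_apply, Fin.sum_univ_two]

variable {A} in
lemma smul_mul_of_central {δ : A} (h : δ ∈ Subring.center A)
    (M N : Matrix (Fin 2) (Fin 2) A) : M * (δ • N) = δ • (M * N) := by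
  ext i j
  simp only [Matrix.mul_apply, Matrix.smul_apply, smul_eq_mul, Finset.mul_sum]
  refine Finset.sum_congr rfl fun k _ => ?_
  rw [← mul_assoc, ← mul_assoc, Subring.mem_center_iff.mp h]

variable [StarRing A]

/-- `δ` is a central invertible symmetric element of `A`. -/
def IsCentralUnitSym (δ : A) : Prop :=
  δ ∈ Subring.center A ∧ IsUnit δ ∧ star δ = δ

/-- The group `GL_*(2, A)` of invertible matrices `g` with `g^* J g = δ(g) J` for some central
invertible symmetric `δ(g)`, where `g^*` is the `*`-transpose of `g`. -/
def GLStar : Subgroup (Matrix (Fin 2) (Fin 2) A)ˣ where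
  carrier := {g | ∃ δ : A, IsCentralUnitSym A δ ∧
    (g : Matrix (Fin 2) (Fin 2) A)ᴴ * J A * (g : Matrix (Fin 2) (Fin 2) A) = δ • J A}
  one_mem' := ⟨1, ⟨one_mem _, isUnit_one, star_one A⟩, by simp⟩
  mul_mem' := by
    rintro g h ⟨δ, ⟨hc, hu, hs⟩, hg⟩ ⟨ε, ⟨hc', hu', hs'⟩, hh⟩
    refine ⟨δ * ε, ⟨mul_mem hc hc', hu.mul hu', ?_⟩, ?_⟩
    · rw [star_mul, hs, hs', Subring.mem_center_iff.mp hc]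
    · calc ((g * h : (Matrix (Fin 2) (Fin 2) A)ˣ) : Matrix (Fin 2) (Fin 2) A)ᴴ * J A *
            ((g * h : (Matrix (Fin 2) (Fin 2) A)ˣ) : Matrix (Fin 2) (Fin 2) A)
          = (h : Matrix (Fin 2) (Fin 2) A)ᴴ * ((g : Matrix (Fin 2) (Fin 2) A)ᴴ * J A *
              (g : Matrix (Fin 2) (Fin 2) A)) * (h : Matrix (Fin 2) (Fin 2) A) := by
            rw [Units.val_mul, Matrix.conjTranspose_mul]; simp only [mul_assoc]
        _ = (δ * ε) • J A := by
            rw [hg, smul_mul_of_central hc, Matrix.smul_mul, hh, smul_smul]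
  inv_mem' := by
    rintro g ⟨δ, ⟨hc, ⟨u, rfl⟩, hs⟩, hg⟩
    have hcu : ((u⁻¹ : Aˣ) : A) ∈ Subring.center A := by
      rw [Subring.mem_center_iff] at hc ⊢
      intro x
      calc x * ((u⁻¹ : Aˣ) : A) = ((u⁻¹ : Aˣ) : A) * (u * x) * ((u⁻¹ : Aˣ) : A) := by simp
        _ = ((u⁻¹ : Aˣ) : A) * x := by rw [← hc x]; simp [mul_assoc]
    refine ⟨((u⁻¹ : Aˣ) : A), ⟨hcu, (u⁻¹).isUnit, ?_⟩, ?_⟩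
    · have h1 : star ((u⁻¹ : Aˣ) : A) * u = 1 := by
        conv_lhs => rw [← hs, ← star_mul, Units.mul_inv, star_one]
      calc star ((u⁻¹ : Aˣ) : A) = star ((u⁻¹ : Aˣ) : A) * u * ((u⁻¹ : Aˣ) : A) := by simp
        _ = _ := by rw [h1, one_mul]
    · have h2 : ((g⁻¹ : (Matrix (Fin 2) (Fin 2) A)ˣ) : Matrix (Fin 2) (Fin 2) A)ᴴ *
          (g : Matrix (Fin 2) (Fin 2) A)ᴴ = 1 := by
        rw [← Matrix.conjTranspose_mul, Units.mul_inv, Matrix.conjTranspose_one]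
      have h3 : J A = ((u⁻¹ : Aˣ) : A) • ((g : Matrix (Fin 2) (Fin 2) A)ᴴ * J A *
          (g : Matrix (Fin 2) (Fin 2) A)) := by
        rw [hg, smul_smul, Units.inv_mul, one_smul]
      conv_lhs => rw [h3]
      rw [smul_mul_of_central hcu, Matrix.smul_mul]
      congr 1
      calc _ = (((g⁻¹ : (Matrix (Fin 2) (Fin 2) A)ˣ) : Matrix (Fin 2) (Fin 2) A)ᴴ *
          (g : Matrix (Fin 2) (Fin 2) A)ᴴ) * J A * ((g : Matrix (Fin 2) (Fin 2) A) *
          ((g⁻¹ : (Matrix (Fin 2) (Fin 2) A)ˣ) : Matrix (Fin 2) (Fin 2) A)) := by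
            simp only [mul_assoc]
        _ = J A := by rw [h2, Units.mul_inv, one_mul, mul_one]

variable {A}

/-- The formula `a d^* - b c^*` for the `*`-determinant of `(a b; c d)`. -/
def starDet (g : Matrix (Fin 2) (Fin 2) A) : A :=
  g 0 0 * star (g 1 1) - g 0 1 * star (g 1 0)

lemma starDet_eq {g : (Matrix (Fin 2) (Fin 2) A)ˣ} {δ : A} (hδ : IsCentralUnitSym A δ)
    (hg : (g : Matrix (Fin 2) (Fin 2) A)ᴴ * J A * (g : Matrix (Fin 2) (Fin 2) A) = δ • J A) :
    starDet (g : Matrix (Fin 2) (Fin 2) A) = δ := by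
  have key : (g : Matrix (Fin 2) (Fin 2) A) * J A * (g : Matrix (Fin 2) (Fin 2) A)ᴴ = δ • J A := by
    have h1 : (g : Matrix (Fin 2) (Fin 2) A) * J A * (g : Matrix (Fin 2) (Fin 2) A)ᴴ * J A *
        (g : Matrix (Fin 2) (Fin 2) A) = δ • J A * J A * (g : Matrix (Fin 2) (Fin 2) A) := by
      calc _ = (g : Matrix (Fin 2) (Fin 2) A) * J A * ((g : Matrix (Fin 2) (Fin 2) A)ᴴ * J A *
            (g : Matrix (Fin 2) (Fin 2) A)) := by simp only [mul_assoc]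
        _ = _ := by
          rw [hg, smul_mul_of_central hδ.1, mul_assoc, Matrix.smul_mul, J_mul_J, Matrix.smul_mul]
          simp
    have h2 := congrArg (fun M => M * ((g⁻¹ : (Matrix (Fin 2) (Fin 2) A)ˣ) :
      Matrix (Fin 2) (Fin 2) A)) h1
    simp only [Units.mul_inv_cancel_right] at h2
    have h3 := congrArg (fun M => M * J A) h2
    simp only [mul_assoc, J_mul_J] at h3
    simpa [mul_assoc] using h3
  have h := congrFun (congrFun key 0) 1
  simp [J, Matrix.mul_apply, Fin.sum_univ_two] at h
  rw [starDet, ← h]; abel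

variable (A)

/-- The homomorphism `det_* : GL_*(2, A) → A`, with values in the central invertible symmetric
elements (see `starDet_mem`), given by `det_* (a b; c d) = a d^* - b c^*`. -/
def detStar : GLStar A →* A where
  toFun g := starDet (g.1 : Matrix (Fin 2) (Fin 2) A)
  map_one' := by simp [starDet]
  map_mul' := by
    rintro ⟨g, δ, hδ, hg⟩ ⟨h, ε, hε, hh⟩
    obtain ⟨η, hη, hgh⟩ := (GLStar A).mul_mem ⟨δ, hδ, hg⟩ ⟨ε, hε, hh⟩
    change starDet ((g * h : (Matrix (Fin 2) (Fin 2) A)ˣ) : Matrix (Fin 2) (Fin 2) A) =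
      starDet (g : Matrix (Fin 2) (Fin 2) A) * starDet (h : Matrix (Fin 2) (Fin 2) A)
    rw [starDet_eq hδ hg, starDet_eq hε hh, starDet_eq hη hgh]
    have e : η • J A = (δ * ε) • J A := by
      rw [← hgh]
      calc ((g * h : (Matrix (Fin 2) (Fin 2) A)ˣ) : Matrix (Fin 2) (Fin 2) A)ᴴ * J A *
            ((g * h : (Matrix (Fin 2) (Fin 2) A)ˣ) : Matrix (Fin 2) (Fin 2) A)
          = (h : Matrix (Fin 2) (Fin 2) A)ᴴ * ((g : Matrix (Fin 2) (Fin 2) A)ᴴ * J A *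
              (g : Matrix (Fin 2) (Fin 2) A)) * (h : Matrix (Fin 2) (Fin 2) A) := by
            rw [Units.val_mul, Matrix.conjTranspose_mul]; simp only [mul_assoc]
        _ = (δ * ε) • J A := by
            rw [hg, smul_mul_of_central hδ.1, Matrix.smul_mul, hh, smul_smul]
    simpa [J] using congrFun (congrFun e 0) 1

lemma starDet_mem (g : GLStar A) : IsCentralUnitSym A (detStar A g) := by
  obtain ⟨g, δ, hδ, hg⟩ := g
  change IsCentralUnitSym A (starDet (g : Matrix (Fin 2) (Fin 2) A))
  rwa [starDet_eq hδ hg]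

/-- The group `SL_*(2, A)`, the kernel of `det_*`, as a group of invertible matrices over `A`. -/
def SLStar : Subgroup (Matrix (Fin 2) (Fin 2) A)ˣ :=
  (detStar A).ker.map (GLStar A).subtype

variable {A}

/-- The Bruhat element `h_a = (a^* 0; 0 a⁻¹)`, for a unit `a` of `A`. -/
def bruhatH (a : Aˣ) : (Matrix (Fin 2) (Fin 2) A)ˣ where
  val := !![star (a : A), 0; 0, ((a⁻¹ : Aˣ) : A)]
  inv := !![star ((a⁻¹ : Aˣ) : A), 0; 0, (a : A)]
  val_inv := by
    simp [← star_mul, Matrix.one_fin_two]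
  inv_val := by
    simp [← star_mul, Matrix.one_fin_two]

/-- The matrix `u_b = (1 b; 0 1)`. -/
def bruhatU (b : A) : (Matrix (Fin 2) (Fin 2) A)ˣ where
  val := !![1, b; 0, 1]
  inv := !![1, -b; 0, 1]
  val_inv := by simp [Matrix.one_fin_two]
  inv_val := by simp [Matrix.one_fin_two]

variable (A)

/-- The Bruhat element `ω = (0 1; -1 0)`. -/
def bruhatOmega : (Matrix (Fin 2) (Fin 2) A)ˣ where
  val := !![0, 1; -1, 0]
  inv := !![0, -1; 1, 0]
  val_inv := by simp [Matrix.one_fin_two]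
  inv_val := by simp [Matrix.one_fin_two]

/-- The set of Bruhat elements: `h_a` for `a` a unit of `A`, `u_b` for `b` a symmetric element of
`A`, and `ω`. -/
def bruhatElements : Set (Matrix (Fin 2) (Fin 2) A)ˣ :=
  {g | ∃ a : Aˣ, g = bruhatH a} ∪ {g | ∃ b : A, star b = b ∧ g = bruhatU b} ∪ {bruhatOmega A}

end SLStar

/-! ### `*`-local rings -/

section StarLocal

variable (R : Type*) [Ring R]

/-- A ring is `l`-maximal if every maximal left ideal is a two-sided ideal. -/
def IsLMaximal : Prop := ∀ I : Ideal R, I.IsMaximal → I.IsTwoSided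

variable {R} in
/-- A two-sided ideal `I` is stable if `I^* = I`. -/
def IsStableIdeal [StarRing R] (I : Ideal R) : Prop :=
  I.IsTwoSided ∧ star '' (I : Set R) = (I : Set R)

/-- A `*`-local ring is an `l`-maximal ring with involution which has a unique stable maximal ideal,
that is, a unique maximal element among the proper stable two-sided ideals. -/
structure IsStarLocalRing [StarRing R] : Prop where
  lMaximal : IsLMaximal R
  existsUnique_stableMaximal :
    ∃! I : Ideal R, Maximal (fun K : Ideal R => K ≠ ⊤ ∧ IsStableIdeal K) I

end StarLocal

/-! ### Places and adeles -/

section Places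

variable (F : Type*) [Field F]

/-- Equivalence of nontrivial absolute values. -/
def placeSetoid : Setoid {v : AbsoluteValue F ℝ // v.IsNontrivial} where
  r v w := v.1.IsEquiv w.1
  iseqv := ⟨fun _ => .rfl, fun h => h.symm, fun h h' => h.trans h'⟩

/-- The places of a field: equivalence classes of nontrivial absolute values. -/
def Place : Type _ := Quotient (placeSetoid F)

namespace Place

variable {F}

/-- The place defined by a nontrivial absolute value. -/
def mk (v : AbsoluteValue F ℝ) (hv : v.IsNontrivial) : Place F :=
  Quotient.mk (placeSetoid F) ⟨v, hv⟩

/-- A chosen absolute value in the class `v`. The completion at `v`, as a topological field, its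
unit ball when `v` is non-archimedean, and the property of being non-archimedean do not depend on
the choice. -/
noncomputable def abs (v : Place F) : AbsoluteValue F ℝ := (Quotient.out v).1

lemma abs_isNontrivial (v : Place F) : v.abs.IsNontrivial := (Quotient.out v).2

lemma abs_mk (v : AbsoluteValue F ℝ) (hv : v.IsNontrivial) : (mk v hv).abs.IsEquiv v :=
  Quotient.mk_out (s := placeSetoid F) ⟨v, hv⟩

lemma mk_eq {v w : AbsoluteValue F ℝ} (hv : v.IsNontrivial) (hw : w.IsNontrivial)
    (h : v.IsEquiv w) : mk v hv = mk w hw :=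
  Quotient.sound (s := placeSetoid F) h

lemma ext_abs {v w : Place F} (h : v.abs.IsEquiv w.abs) : v = w :=
  Quotient.out_equiv_out.mp h

/-- The completion `F_v`. -/
abbrev Completion (v : Place F) : Type _ := v.abs.Completion

/-- The place `v` is non-archimedean. -/
def IsNonarch (v : Place F) : Prop := IsNonarchimedean (v.abs : F → ℝ)

lemma norm_add_le_max {v : Place F} (hv : v.IsNonarch) (x y : v.Completion) :
    ‖x + y‖ ≤ max ‖x‖ ‖y‖ := by
  induction x, y using UniformSpace.Completion.induction_on₂ with
  | hp =>
    exact isClosed_le (by fun_prop) (by fun_prop)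
  | ih a b =>
    rw [← UniformSpace.Completion.coe_add]
    simp only [UniformSpace.Completion.norm_coe, WithAbs.norm_eq_apply_ofAbs]
    exact hv _ _

/-- For a non-archimedean place `v`, this is the ring of integers `O_v = {x ∈ F_v : |x|_v ≤ 1}`;
for an archimedean place it is all of `F_v`. -/
noncomputable def integers (v : Place F) : Subring v.Completion where
  carrier := {x | v.IsNonarch → ‖x‖ ≤ 1}
  zero_mem' _ := by simp
  one_mem' _ := by simp
  add_mem' hx hy hv := (norm_add_le_max hv _ _).trans (max_le (hx hv) (hy hv))
  mul_mem' hx hy hv := by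
    rw [norm_mul]; exact mul_le_one₀ (hx hv) (norm_nonneg _) (hy hv)
  neg_mem' hx hv := by rw [norm_neg]; exact hx hv

lemma mem_integers {v : Place F} {x : v.Completion} :
    x ∈ v.integers ↔ (v.IsNonarch → ‖x‖ ≤ 1) := Iff.rfl

end Place

/-- The adele ring of `F` (meant for a global field): the restricted product of the completions
`F_v` over all places `v` of `F` with respect to the rings of integers `O_v`, `v` non-archimedean.
(A global field has only finitely many archimedean places.) -/
abbrev AdeleRing : Type _ := Πʳ v : Place F, [v.Completion, v.integers]

end Places

/-! ### The action of automorphisms on adeles -/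

section Galois

variable {E : Type*} [Field E]

namespace Place

lemma comp_isNontrivial (σ : E ≃+* E) {v : AbsoluteValue E ℝ} (hv : v.IsNontrivial) :
    (v.comp (f := σ.toRingHom) σ.injective).IsNontrivial := by
  obtain ⟨x, hx, hx'⟩ := hv
  exact ⟨σ.symm x, by simpa using hx, by simpa [AbsoluteValue.comp] using hx'⟩

/-- The place `v ∘ σ`: the class of `x ↦ |σ x|_v`. -/
noncomputable def comap (σ : E ≃+* E) (v : Place E) : Place E :=
  mk (v.abs.comp (f := σ.toRingHom) σ.injective) (comp_isNontrivial σ v.abs_isNontrivial)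

lemma comap_abs (σ : E ≃+* E) (v : Place E) (x y : E) :
    (comap σ v).abs x ≤ (comap σ v).abs y ↔ v.abs (σ x) ≤ v.abs (σ y) :=
  abs_mk _ _ x y

lemma comap_injective (σ : E ≃+* E) : Function.Injective (comap σ) := by
  intro v w h
  apply ext_abs
  intro x y
  have h1 := comap_abs σ v (σ.symm x) (σ.symm y)
  have h2 := comap_abs σ w (σ.symm x) (σ.symm y)
  rw [h] at h1
  simpa using h1.symm.trans h2

lemma comap_comap (σ : E ≃+* E) (hσ : ∀ x, σ (σ x) = x) (v : Place E) :
    comap σ (comap σ v) = v := by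
  apply ext_abs
  intro x y
  rw [comap_abs, comap_abs, hσ, hσ]

variable {σ : E ≃+* E} {v w : Place E}

lemma exists_rpow (h : ∀ x y, w.abs x ≤ w.abs y ↔ v.abs (σ x) ≤ v.abs (σ y)) :
    ∃ c : ℝ, 0 < c ∧ ∀ x, v.abs (σ x) = w.abs x ^ c := by
  have h' : w.abs.IsEquiv (v.abs.comp (f := σ.toRingHom) σ.injective) := h
  obtain ⟨c, hc, hcc⟩ := AbsoluteValue.isEquiv_iff_exists_rpow_eq.mp h'
  exact ⟨c, hc, fun x => (congrFun hcc x).symm⟩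

lemma continuous_map (h : ∀ x y, w.abs x ≤ w.abs y ↔ v.abs (σ x) ≤ v.abs (σ y)) :
    Continuous (WithAbs.map w.abs v.abs σ.toRingHom) := by
  obtain ⟨c, hc, hcc⟩ := exists_rpow h
  refine continuous_of_continuousAt_zero _ ?_
  rw [ContinuousAt, map_zero, tendsto_zero_iff_norm_tendsto_zero]
  have h1 : ∀ x : WithAbs w.abs, ‖WithAbs.map w.abs v.abs σ.toRingHom x‖ = ‖x‖ ^ c := fun x => by
    rw [WithAbs.norm_eq_apply_ofAbs, WithAbs.norm_eq_apply_ofAbs]; exact hcc _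
  simp only [h1]
  have h2 : Continuous fun x : WithAbs w.abs => ‖x‖ ^ c :=
    continuous_norm.rpow_const fun _ => Or.inr hc.le
  have := h2.tendsto 0
  simpa [Real.zero_rpow hc.ne'] using this

/-- If `w` is the place `v ∘ σ`, the continuous extension `E_w → E_v` of `σ`. -/
noncomputable def completionMap (h : ∀ x y, w.abs x ≤ w.abs y ↔ v.abs (σ x) ≤ v.abs (σ y)) :
    w.Completion →+* v.Completion :=
  UniformSpace.Completion.mapRingHom (WithAbs.map w.abs v.abs σ.toRingHom) (continuous_map h)

lemma completionMap_coe (h : ∀ x y, w.abs x ≤ w.abs y ↔ v.abs (σ x) ≤ v.abs (σ y))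
    (x : WithAbs w.abs) :
    completionMap h (x : w.Completion) = (WithAbs.map w.abs v.abs σ.toRingHom x : v.Completion) :=
  UniformSpace.Completion.mapRingHom_coe (continuous_map h) x

lemma continuous_completionMap (h : ∀ x y, w.abs x ≤ w.abs y ↔ v.abs (σ x) ≤ v.abs (σ y)) :
    Continuous (completionMap h) :=
  UniformSpace.Completion.continuous_map

lemma completionMap_mem (h : ∀ x y, w.abs x ≤ w.abs y ↔ v.abs (σ x) ≤ v.abs (σ y))
    {x : w.Completion} (hx : x ∈ w.integers) : completionMap h x ∈ v.integers := by
  intro hv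
  obtain ⟨c, hc, hcc⟩ := exists_rpow h
  have hw : w.IsNonarch := by
    intro a b
    rw [le_max_iff, h, h, map_add, ← le_max_iff]
    exact hv _ _
  have h1 : ∀ x : w.Completion, ‖completionMap h x‖ = ‖x‖ ^ c := fun x => by
    induction x using UniformSpace.Completion.induction_on with
    | hp =>
      exact isClosed_eq (continuous_completionMap h).norm
        (continuous_norm.rpow_const fun _ => Or.inr hc.le)
    | ih a =>
      rw [completionMap_coe, UniformSpace.Completion.norm_coe, UniformSpace.Completion.norm_coe,
        WithAbs.norm_eq_apply_ofAbs, WithAbs.norm_eq_apply_ofAbs]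
      exact hcc _
  rw [h1]
  exact Real.rpow_le_one (norm_nonneg _) (hx hw) hc.le

lemma completionMap_completionMap (hσ : ∀ x, σ (σ x) = x) {u : Place E} (e : u = v)
    (h : ∀ x y, w.abs x ≤ w.abs y ↔ v.abs (σ x) ≤ v.abs (σ y))
    (h' : ∀ x y, u.abs x ≤ u.abs y ↔ w.abs (σ x) ≤ w.abs (σ y)) (x : ∀ v : Place E, v.Completion) :
    completionMap h (completionMap h' (x u)) = x v := by
  subst e
  generalize x u = z
  induction z using UniformSpace.Completion.induction_on with
  | hp =>
    exact isClosed_eq ((continuous_completionMap h).comp (continuous_completionMap h'))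
      continuous_id
  | ih a =>
    rw [completionMap_coe, completionMap_coe]
    congr 1
    simp [hσ]

end Place

/-- The automorphism of the adele ring of `E` induced by an automorphism `σ` of `E`:
`(σ x)_v` is the image of `x_{v ∘ σ}` under the continuous extension `E_{v ∘ σ} → E_v` of `σ`. -/
noncomputable def adeleMap (σ : E ≃+* E) : AdeleRing E →+* AdeleRing E :=
  RestrictedProduct.mapAlongRingHom (fun v : Place E => v.Completion)
    (fun v : Place E => v.Completion) (Place.comap σ) (Place.comap_injective σ).tendsto_cofinite
    (fun v => Place.completionMap (Place.comap_abs σ v))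
    (Filter.Eventually.of_forall fun _ _ hx => Place.completionMap_mem _ hx)

/-- The involution of the adele ring of `E` induced by an automorphism `σ` of `E` with `σ² = 1`. -/
@[reducible]
noncomputable def galoisStarRing (σ : E ≃+* E) (hσ : ∀ x, σ (σ x) = x) :
    StarRing (AdeleRing E) where
  star := adeleMap σ
  star_involutive x := by
    ext v
    exact Place.completionMap_completionMap hσ (Place.comap_comap σ hσ v) (Place.comap_abs σ v)
      (Place.comap_abs σ (Place.comap σ v)) x
  star_mul x y := by
    change adeleMap σ (x * y) = adeleMap σ y * adeleMap σ x
    rw [map_mul, mul_comm]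
  star_add x y := map_add (adeleMap σ) x y

lemma apply_apply_of_finrank_eq_two {F : Type*} [Field F] [Algebra F E]
    (h : Module.finrank F E = 2) (σ : E ≃ₐ[F] E) (x : E) : σ (σ x) = x := by
  by_cases h1 : σ = 1
  · simp [h1]
  have : FiniteDimensional F E := Module.finite_of_finrank_pos (by omega)
  have hle : Nat.card (E ≃ₐ[F] E) ≤ 2 := by
    rw [Nat.card_eq_fintype_card]; exact h ▸ AlgEquiv.card_le
  have : Nontrivial (E ≃ₐ[F] E) := ⟨σ, 1, h1⟩
  have hlt : 1 < Nat.card (E ≃ₐ[F] E) := Finite.one_lt_card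
  have h2 : σ ^ 2 = 1 := by
    have : Nat.card (E ≃ₐ[F] E) = 2 := by omega
    rw [← this]; exact pow_card_eq_one'
  have := congrArg (fun τ : E ≃ₐ[F] E => τ x) h2
  simpa [pow_two] using this

end Galois

/-! ### Global fields and the diagonal embedding -/

/-- A global field is a number field or a finite extension of `𝔽_p(t)` for some prime `p`. -/
class IsGlobalField (F : Type*) [Field F] : Prop where
  out : NumberField F ∨ ∃ (p : ℕ) (_ : Fact p.Prime) (_ : Algebra (RatFunc (ZMod p)) F),
    FunctionField (ZMod p) F

section Finiteness

namespace Place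

lemma isEquiv_of_ideal {B K : Type*} [CommRing B] [IsDomain B] [IsPrincipalIdealRing B] [Field K]
    [Algebra B K] [IsFractionRing B K] {v w : AbsoluteValue K ℝ} (hv : v.IsNontrivial)
    (hv1 : ∀ b : B, v (algebraMap B K b) ≤ 1) (hw1 : ∀ b : B, w (algebraMap B K b) ≤ 1)
    (h : ∀ b : B, v (algebraMap B K b) < 1 ↔ w (algebraMap B K b) < 1)
    (hvn : IsNonarchimedean (v : K → ℝ)) : v.IsEquiv w := by
  refine AbsoluteValue.isEquiv_of_lt_one_imp hv fun x hx => ?_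
  obtain ⟨a, d, hrel, hxe⟩ := IsFractionRing.exists_reduced_fraction B x
  have hd0 : algebraMap B K d ≠ 0 := by
    simp
  have hxa : x * algebraMap B K d = algebraMap B K a := by
    rw [← hxe, IsLocalization.mk'_spec]
  have hva : v (algebraMap B K a) < 1 := by
    rw [← hxa, map_mul]
    exact mul_lt_one_of_nonneg_of_lt_one_left (v.nonneg _) hx (hv1 _)
  have hvd : ¬ v (algebraMap B K d) < 1 := by
    intro hd
    obtain ⟨r, s, hrs⟩ := hrel.isCoprime
    have h1 : v (algebraMap B K (r * a + s * d)) < 1 := by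
      rw [map_add, map_mul, map_mul]
      refine (hvn _ _).trans_lt (max_lt ?_ ?_) <;> rw [map_mul]
      · exact mul_lt_one_of_nonneg_of_lt_one_right (hv1 _) (v.nonneg _) hva
      · exact mul_lt_one_of_nonneg_of_lt_one_right (hv1 _) (v.nonneg _) hd
    rw [hrs, map_one, map_one] at h1
    exact lt_irrefl _ h1
  have hwa := (h a).mp hva
  have hwd : w (algebraMap B K d) = 1 :=
    le_antisymm (hw1 _) (not_lt.mp fun hlt => hvd ((h _).mpr hlt))
  rw [← hxa, map_mul, hwd, mul_one] at hwa
  exact hwa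

lemma finite_of_pid (B : Type*) {K : Type*} [CommRing B] [IsDomain B] [IsPrincipalIdealRing B]
    [Field K] [Algebra B K] [IsFractionRing B K] (x : K) :
    {v : Place K | v.IsNonarch ∧ (∀ b : B, v.abs (algebraMap B K b) ≤ 1) ∧ 1 < v.abs x}.Finite := by
  obtain ⟨⟨a, d⟩, hxa⟩ := IsLocalization.surj (nonZeroDivisors B) x
  simp only at hxa
  have hd0 : (d : B) ≠ 0 := nonZeroDivisors.ne_zero d.2
  have hfin := Ideal.finite_factors (R := B) (I := Ideal.span {(d : B)}) (by simp)
  let J : Place K → Set B := fun v => {b | v.abs (algebraMap B K b) < 1}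
  refine Set.Finite.of_finite_image (f := J)
    ((hfin.image fun P => (P.asIdeal : Set B)).subset ?_) ?_
  · rintro _ ⟨v, ⟨hv, hv1, hvx⟩, rfl⟩
    have hvd : v.abs (algebraMap B K d) < 1 := by
      by_contra hlt
      have h1 : v.abs (algebraMap B K d) = 1 := le_antisymm (hv1 _) (not_lt.mp hlt)
      have h2 := hv1 a
      rw [← hxa, map_mul, h1, mul_one] at h2
      exact absurd hvx (not_lt.mpr h2)
    let P : Ideal B :=
      { carrier := J v
        zero_mem' := by simp [J]
        add_mem' := fun {b c} hb hc => by
          change v.abs (algebraMap B K (b + c)) < 1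
          rw [map_add]; exact (hv _ _).trans_lt (max_lt hb hc)
        smul_mem' := fun r b hb => by
          change v.abs (algebraMap B K (r * b)) < 1
          rw [map_mul, map_mul]
          exact mul_lt_one_of_nonneg_of_lt_one_right (hv1 _) (v.abs.nonneg _) hb }
    have hP : P.IsPrime := by
      refine ⟨fun htop => ?_, fun {b c} hbc => ?_⟩
      · have : (1 : B) ∈ P := htop ▸ Submodule.mem_top
        have h1 : v.abs (algebraMap B K 1) < 1 := this
        simp at h1
      · by_contra hcon
        rw [not_or] at hcon
        have h1 : v.abs (algebraMap B K (b * c)) < 1 := hbc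
        have h2 : v.abs (algebraMap B K b) = 1 := le_antisymm (hv1 _) (not_lt.mp hcon.1)
        have h3 : v.abs (algebraMap B K c) = 1 := le_antisymm (hv1 _) (not_lt.mp hcon.2)
        rw [map_mul, map_mul, h2, h3] at h1
        simp at h1
    have hPd : (d : B) ∈ P := hvd
    refine ⟨⟨P, hP, fun h0 => hd0 ((Submodule.mem_bot B).mp (h0 ▸ hPd))⟩, ?_, rfl⟩
    exact Ideal.dvd_span_singleton.mpr hPd
  · rintro v ⟨hv, hv1, -⟩ w ⟨-, hw1, -⟩ he
    exact ext_abs (isEquiv_of_ideal v.abs_isNontrivial hv1 hw1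
      (fun b => Set.ext_iff.mp he b) hv)

/-- There are only finitely many non-archimedean places where a given element is not integral. -/
def HasFiniteDenominators (K : Type*) [Field K] : Prop :=
  ∀ x : K, {v : Place K | v.IsNonarch ∧ 1 < v.abs x}.Finite

lemma hasFiniteDenominators_rat : HasFiniteDenominators ℚ := by
  intro x
  refine (finite_of_pid ℤ x).subset fun v hv => ⟨hv.1, fun b => ?_, hv.2⟩
  simpa using hv.1.apply_intCast_le_one (f := v.abs) (n := b)

section RatFunc

variable {k : Type*} [Field k] [Finite k]

lemma abs_algebraMap_of_finite {K : Type*} [Field K] [Algebra k K] (v : AbsoluteValue K ℝ) {c : k}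
    (hc : c ≠ 0) : v (algebraMap k K c) = 1 := by
  have := Fintype.ofFinite k
  have h : v (algebraMap k K c) ^ (Fintype.card k - 1) = 1 := by
    rw [← map_pow, ← map_pow, FiniteField.pow_card_sub_one_eq_one c hc, map_one, map_one]
  exact (pow_eq_one_iff_of_nonneg (v.nonneg _)
    (by have := Fintype.one_lt_card (α := k); omega)).mp h

lemma abs_polynomial_le {v : AbsoluteValue (RatFunc k) ℝ}
    (hv : IsNonarchimedean (v : RatFunc k → ℝ)) (hX : v RatFunc.X ≤ 1) (f : Polynomial k) :
    v (algebraMap (Polynomial k) (RatFunc k) f) ≤ 1 := by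
  induction f using Polynomial.induction_on' with
  | add p q hp hq =>
    rw [map_add]; exact (hv _ _).trans (max_le hp hq)
  | monomial n a =>
    rw [← Polynomial.C_mul_X_pow_eq_monomial, map_mul, map_pow, map_mul, map_pow,
      RatFunc.algebraMap_X, RatFunc.algebraMap_C]
    rcases eq_or_ne a 0 with rfl | ha
    · simp
    · have : v (RatFunc.C a) = 1 := abs_algebraMap_of_finite v ha
      rw [this, one_mul]
      exact pow_le_one₀ (v.nonneg _) hX

lemma abs_polynomial_eq {v : AbsoluteValue (RatFunc k) ℝ}
    (hv : IsNonarchimedean (v : RatFunc k → ℝ)) (hX : 1 < v RatFunc.X) {f : Polynomial k}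
    (hf : f ≠ 0) :
    v (algebraMap (Polynomial k) (RatFunc k) f) = v RatFunc.X ^ f.natDegree := by
  induction hn : f.natDegree using Nat.strong_induction_on generalizing f with
  | _ n ih =>
  have hlead : v (algebraMap (Polynomial k) (RatFunc k)
      (Polynomial.monomial f.natDegree f.leadingCoeff)) = v RatFunc.X ^ n := by
    rw [← Polynomial.C_mul_X_pow_eq_monomial, map_mul, map_pow, map_mul, map_pow,
      RatFunc.algebraMap_X, RatFunc.algebraMap_C]
    have : v (RatFunc.C f.leadingCoeff) = 1 :=
      abs_algebraMap_of_finite v (Polynomial.leadingCoeff_ne_zero.mpr hf)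
    rw [this, one_mul, hn]
  have hsum : f.eraseLead + Polynomial.monomial f.natDegree f.leadingCoeff = f :=
    Polynomial.eraseLead_add_monomial_natDegree_leadingCoeff f
  rcases eq_or_ne f.eraseLead 0 with h0 | h0
  · rw [h0, zero_add] at hsum
    rw [hsum] at hlead
    exact hlead
  · have hlt : f.eraseLead.natDegree < n := by
      rcases Nat.eq_zero_or_pos n with hn0 | hn0
      · exfalso
        rw [hn0] at hn
        rw [Polynomial.eq_C_of_natDegree_eq_zero hn] at h0
        simp at h0
      · have := Polynomial.eraseLead_natDegree_le f
        omega
    have h1 := ih _ hlt h0 rfl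
    rw [← hsum, map_add, hv.add_eq_right_of_lt, hlead]
    rw [hlead, h1]
    exact pow_lt_pow_right₀ hX hlt

lemma hasFiniteDenominators_ratFunc : HasFiniteDenominators (RatFunc k) := by
  intro x
  have h1 := finite_of_pid (Polynomial k) x
  have h2 : {v : Place (RatFunc k) | v.IsNonarch ∧ 1 < v.abs RatFunc.X}.Subsingleton := by
    rintro v ⟨hv, hvX⟩ w ⟨hw, hwX⟩
    refine ext_abs (AbsoluteValue.isEquiv_of_lt_one_imp v.abs_isNontrivial fun y hy => ?_)
    obtain ⟨⟨a, d⟩, hya⟩ := IsLocalization.surj (nonZeroDivisors (Polynomial k)) y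
    simp only at hya
    have hd0 : (d : Polynomial k) ≠ 0 := nonZeroDivisors.ne_zero d.2
    rcases eq_or_ne a 0 with ha | ha
    · rw [ha, map_zero] at hya
      have hy0 : y = 0 := by simpa [hd0] using hya
      simp [hy0]
    have key : ∀ u : Place (RatFunc k), u.IsNonarch → 1 < u.abs RatFunc.X →
        (u.abs y < 1 ↔ a.natDegree < (d : Polynomial k).natDegree) := by
      intro u hu huX
      have h3 : u.abs y * u.abs RatFunc.X ^ (d : Polynomial k).natDegree =
          u.abs RatFunc.X ^ a.natDegree := by
        rw [← abs_polynomial_eq hu huX hd0, ← map_mul, hya, abs_polynomial_eq hu huX ha]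
      rw [← pow_lt_pow_iff_right₀ huX, ← h3]
      have h4 : 0 < u.abs RatFunc.X ^ (d : Polynomial k).natDegree :=
        pow_pos (zero_lt_one.trans huX) _
      exact (mul_lt_iff_lt_one_left h4).symm
    exact (key w hw hwX).mpr ((key v hv hvX).mp hy)
  refine (h1.union h2.finite).subset fun v hv => ?_
  rcases le_or_gt (v.abs RatFunc.X) 1 with hX | hX
  · exact Or.inl ⟨hv.1, abs_polynomial_le hv.1 hX, hv.2⟩
  · exact Or.inr ⟨hv.1, hX⟩

end RatFunc

section Extension

variable {K L : Type*} [Field K] [Field L] [Algebra K L] [FiniteDimensional K L]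

lemma finite_fiber (u : AbsoluteValue K ℝ) :
    {v : Place L | v.IsNonarch ∧
      u.IsEquiv (v.abs.comp (algebraMap K L).injective)}.Finite := by
  classical
  by_contra hinf
  obtain ⟨S, hS, hcard⟩ := Set.Infinite.exists_subset_card_eq hinf (Module.finrank K L + 1)
  have hmem : ∀ i : S, i.1.IsNonarch ∧ u.IsEquiv (i.1.abs.comp (algebraMap K L).injective) :=
    fun i => hS i.2
  have hex := AbsoluteValue.exists_one_lt_lt_one_pi_of_not_isEquiv
    (v := fun i : S => i.1.abs) (fun i => i.1.abs_isNontrivial)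
    (fun i j hij he => hij (Subtype.ext (ext_abs he)))
  choose a ha1 ha2 using hex
  have hli : LinearIndependent K a := by
    rw [Fintype.linearIndependent_iff]
    intro g hg
    by_contra hne
    push Not at hne
    obtain ⟨i0, hi0⟩ := hne
    obtain ⟨i, -, hi⟩ := Finset.exists_max_image Finset.univ (fun i : S => u (g i)) ⟨i0, by simp⟩
    have hgi : g i ≠ 0 := by
      intro h0
      have := hi i0 (by simp)
      rw [h0, map_zero] at this
      exact hi0 ((map_eq_zero u).mp (le_antisymm this (u.nonneg _)))
    have hle : ∀ j, i.1.abs (algebraMap K L (g j)) ≤ i.1.abs (algebraMap K L (g i)) := fun j =>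
      ((hmem i).2 _ _).mp (hi j (by simp))
    have hpos : 0 < i.1.abs (algebraMap K L (g i)) := i.1.abs.pos (by simpa using hgi)
    have hsum : g i • a i = -∑ j ∈ Finset.univ.erase i, g j • a j := by
      rw [eq_neg_iff_add_eq_zero, Finset.add_sum_erase Finset.univ (fun j => g j • a j) (Finset.mem_univ i)]
      exact hg
    have hlt : i.1.abs (∑ j ∈ Finset.univ.erase i, g j • a j) <
        i.1.abs (algebraMap K L (g i)) := by
      have : ∀ T : Finset S, i ∉ T → i.1.abs (∑ j ∈ T, g j • a j) <
          i.1.abs (algebraMap K L (g i)) := by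
        intro T
        induction T using Finset.induction_on with
        | empty => intro _; simpa using hgi
        | insert j T hj ih =>
          intro hiT
          rw [Finset.sum_insert hj]
          refine ((hmem i).1 _ _).trans_lt (max_lt ?_ (ih fun h => hiT (by simp [h])))
          rw [Algebra.smul_def, map_mul]
          have hne : i ≠ j := fun h => hiT (by simp [h])
          calc _ ≤ i.1.abs (algebraMap K L (g i)) * i.1.abs (a j) :=
                mul_le_mul_of_nonneg_right (hle j) (i.1.abs.nonneg _)
            _ < i.1.abs (algebraMap K L (g i)) * 1 :=
                mul_lt_mul_of_pos_left (ha2 j i hne) hpos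
            _ = _ := mul_one _
      exact this _ (by simp)
    have h5 : i.1.abs (g i • a i) = i.1.abs (∑ j ∈ Finset.univ.erase i, g j • a j) := by
      rw [hsum, AbsoluteValue.map_neg]
    rw [Algebra.smul_def, map_mul] at h5
    have h6 : i.1.abs (algebraMap K L (g i)) * 1 < i.1.abs (algebraMap K L (g i)) *
        i.1.abs (a i) := mul_lt_mul_of_pos_left (ha1 i) hpos
    rw [mul_one, h5] at h6
    exact lt_asymm h6 hlt
  have := hli.fintype_card_le_finrank
  rw [Fintype.card_coe, hcard] at this
  omega

lemma HasFiniteDenominators.of_finite (hK : HasFiniteDenominators K) :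
    HasFiniteDenominators L := by
  intro x
  have hint : IsIntegral K x := IsIntegral.of_finite K x
  let p := minpoly K x
  let T : Set (Place K) := ⋃ i ∈ Finset.range (p.natDegree + 1),
    {u : Place K | u.IsNonarch ∧ 1 < u.abs (p.coeff i)}
  have hT : T.Finite := (Finset.range (p.natDegree + 1)).finite_toSet.biUnion fun i _ => hK _
  refine (hT.biUnion fun u _ => finite_fiber (L := L) u.abs).subset ?_
  rintro v ⟨hv, hvx⟩
  have hcoeff : ∃ i ∈ Finset.range p.natDegree, 1 < v.abs (algebraMap K L (p.coeff i)) := by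
    by_contra hcon
    push Not at hcon
    have h0 : x ^ p.natDegree + ∑ i ∈ Finset.range p.natDegree,
        algebraMap K L (p.coeff i) * x ^ i = 0 := by
      have h1 := minpoly.aeval K x
      rw [Polynomial.aeval_eq_sum_range, Finset.sum_range_succ, add_comm] at h1
      have h2 : (minpoly K x).coeff (minpoly K x).natDegree = 1 := minpoly.monic hint
      rw [h2, one_smul] at h1
      simpa only [Algebra.smul_def] using h1
    have hlt : ∀ m ≤ p.natDegree, v.abs (∑ i ∈ Finset.range m,
        algebraMap K L (p.coeff i) * x ^ i) < v.abs x ^ m := by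
      intro m hm
      induction m with
      | zero => simp
      | succ m ih =>
        rw [Finset.sum_range_succ]
        have hstep : v.abs x ^ m < v.abs x ^ (m + 1) := pow_lt_pow_right₀ hvx (Nat.lt_succ_self m)
        refine (hv _ _).trans_lt (max_lt ((ih (by omega)).trans hstep) ?_)
        rw [map_mul, map_pow]
        refine lt_of_le_of_lt ?_ hstep
        exact mul_le_of_le_one_left (pow_nonneg (v.abs.nonneg _) _)
          (hcon m (Finset.mem_range.mpr (by omega)))
    have h3 := hlt p.natDegree le_rfl
    rw [add_comm] at h0
    rw [eq_neg_of_add_eq_zero_left h0, AbsoluteValue.map_neg, map_pow] at h3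
    exact lt_irrefl _ h3
  obtain ⟨i, hi, hi1⟩ := hcoeff
  have hnt : (v.abs.comp (algebraMap K L).injective).IsNontrivial := by
    refine ⟨p.coeff i, fun h0 => ?_, ne_of_gt hi1⟩
    rw [h0] at hi1
    simp at hi1
    exact absurd hi1 (by norm_num)
  have he := abs_mk _ hnt
  refine Set.mem_biUnion (x := mk _ hnt) ?_ ⟨hv, he⟩
  refine Set.mem_biUnion (x := i) (Finset.mem_coe.mpr (Finset.mem_range.mpr ?_)) ⟨?_, ?_⟩
  · have := Finset.mem_range.mp hi; omega
  · intro y z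
    rw [le_max_iff, he, he, ← le_max_iff]
    change v.abs (algebraMap K L (y + z)) ≤
      max (v.abs (algebraMap K L y)) (v.abs (algebraMap K L z))
    rw [map_add]
    exact hv _ _
  · exact he.one_lt_iff.mpr hi1

end Extension

lemma hasFiniteDenominators (F : Type*) [Field F] [hF : IsGlobalField F] :
    HasFiniteDenominators F := by
  rcases hF.out with h | ⟨p, hp, h, h'⟩
  · exact hasFiniteDenominators_rat.of_finite
  · exact (hasFiniteDenominators_ratFunc (k := ZMod p)).of_finite

end Place

variable {F : Type*} [Field F] [IsGlobalField F]

/-- The diagonal embedding of a global field in its adele ring. -/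
noncomputable def diagonal : F →+* AdeleRing F where
  toFun x := ⟨fun v => ((WithAbs.toAbs v.abs x : WithAbs v.abs) : v.Completion), by
    refine (Place.hasFiniteDenominators F x).subset fun v hv => ?_
    by_contra hcon
    refine hv fun hna => ?_
    rw [UniformSpace.Completion.norm_coe, WithAbs.norm_toAbs_eq]
    exact not_lt.mp fun h => hcon ⟨hna, h⟩⟩
  map_zero' := by ext v; exact UniformSpace.Completion.coe_zero
  map_one' := by ext v; exact UniformSpace.Completion.coe_one _
  map_add' x y := by ext v; exact UniformSpace.Completion.coe_add _ _
  map_mul' x y := by ext v; exact UniformSpace.Completion.coe_mul _ _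

/-- The adele ring of a global field `F` as an `F`-algebra, through the diagonal embedding. -/
noncomputable instance : Algebra F (AdeleRing F) := diagonal.toAlgebra

end Finiteness

/-! ### Quaternion algebras -/

section Quaternion

variable (F : Type*) [Field F] (H : Type*) [Ring H] [Algebra F H] [StarRing H]

/-- A ring with involution `H` is a quaternion algebra over `F` (with its quaternion conjugation as
the involution) if it is isomorphic to an algebra `L ⊕ L j`, where `L = F[i]`, `i² = a + b i`, is a
separable quadratic `F`-algebra (`b² + 4 a ≠ 0`), `j² = c ≠ 0` and `j x = x̄ j` for `x` in `L`.
The characteristic of `F` is arbitrary. -/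
def IsQuaternionAlgebra : Prop :=
  ∃ a b c : F, b ^ 2 + 4 * a ≠ 0 ∧ c ≠ 0 ∧ Nonempty (H ≃⋆ₐ[F] QuaternionAlgebra F a b c)

variable {F H}

lemma IsQuaternionAlgebra.star_smul (h : IsQuaternionAlgebra F H) (r : F) (x : H) :
    star (r • x) = r • star x := by
  obtain ⟨a, b, c, -, -, ⟨e⟩⟩ := h
  apply EquivLike.injective e
  rw [map_star, map_smul, map_smul, map_star]
  exact QuaternionAlgebra.star_smul _ _

variable [IsGlobalField F]

/-- The involution `x ⊗ y ↦ x^* ⊗ y` of the adelic quaternions `H ⊗_F 𝔸_F`. -/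
@[reducible]
noncomputable def adelicQuaternionStarRing (h : IsQuaternionAlgebra F H) :
    StarRing (H ⊗[F] AdeleRing F) :=
  letI : StarRing F := starRingOfComm
  letI : StarRing (AdeleRing F) := starRingOfComm
  letI : StarModule F H := ⟨fun r x => h.star_smul r x⟩
  letI : StarModule F (AdeleRing F) := ⟨fun _ _ => rfl⟩
  inferInstance

lemma adelicQuaternionStarRing_star_tmul (h : IsQuaternionAlgebra F H) (x : H)
    (y : AdeleRing F) :
    (adelicQuaternionStarRing h).star (x ⊗ₜ[F] y) = star x ⊗ₜ[F] y := rfl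

end Quaternion

end StarBruhat

/-!
A matrix in `SL_*(2, A)` whose top left entry is a unit is a product of Bruhat elements, by Gauss
elimination (`mem_closure_of_isUnit`). Left multiplication by `u_b` turns the first column `(a, c)`
into `(a + b c, c)`. So `SL_*(2, A)` is generated by the Bruhat elements as soon as `A` satisfies a
stable range condition, `IsStarStable`: if `a^* c = c^* a` and `A a + A c = A`, then `a + b c` is a
unit for some symmetric `b` (`IsStarStable.closure_eq`). This is proved for all the matrix rings in
question.

*Residue division rings* (`isStarStable_matrix`). Let `f : R → D` be a surjection onto a division
ring such that `x` is a unit whenever `f x` and `f (x^*)` are nonzero; the kernel of `f` need not be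
stable under the involution. For `A = M(n, R)` proceed by induction on `n`. If `c` dies under `f`,
it dies under `f ∘ *` too, and `a` is a unit. Otherwise, multiplying `c` by units on both sides
makes one of its diagonal entries a unit: permute nonzero entries of `f(c)` and `f(c^*)` to the same
place, gluing the permutation matrices by an element `e` with `f e = 1`, `f (e^*) = 0` when these
entries differ. Clearing the row and the column of this entry leaves a pair of size `n - 1`.
In a `*`-local ring, if `M` is a maximal left ideal, then `M` and `M^*` are the only ones, so that
`R → R / M` is a homomorphism of this kind (`IsStarLocalRing.isUnit`).

*Restricted products* (`isStarStable_matrix_of_local`). The condition may be checked for every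
factor and, for almost all factors, over the distinguished subring. The adeles of `E` with the
involution of a field automorphism `σ` of order at most two are such a product over the orbits of
`σ` on the places. The factor at `w` is `E_w` if `w ∘ σ = w`, and `E_w × E_w` with the exchange
involution otherwise; in both cases the first result applies to the factor and to its ring of
integers. No decomposition theory of places is needed. The trivial involution is the case `σ = 1`.

*Quaternions in characteristic two*. Over a field (`isStarStable_matrix_quaternion_field`), either
the quaternions form a division ring and the first result applies, or they are `M(2, K)` and
conjugation is the transposition twisted by a symmetric permutation matrix, and the twist can be
absorbed in `c`. Over a local ring, units lift from the residue field, and so do the symmetric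
elements, because a quaternion is symmetric if and only if it has no `i`-component. Since the
structure constants are integral, and units where they have to be, at almost all places, the
adelic quaternions are again a restricted product of such rings.
-/

namespace StarBruhat

open scoped Matrix RestrictedProduct TensorProduct Quaternion

/-! ### Bruhat generation from a stable range condition -/

section StarStable

variable {A : Type*} [Ring A] [StarRing A]

/-- The pairs `(a, c)` which can be the first column of a matrix in `SL_*(2, A)`. -/
def IsStarPair (a c : A) : Prop :=
  star a * c = star c * a ∧ ∃ x y : A, x * a + y * c = 1

variable (A) in
/-- The stable range condition for rings with involution: the first entry of every pair
`(a, c)` as in `IsStarPair` becomes invertible after adding to it a symmetric multiple of `c`. -/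
def IsStarStable : Prop :=
  ∀ a c : A, IsStarPair a c → ∃ b : A, star b = b ∧ IsUnit (a + b * c)

/-- The multiplier `δ(g)` equals `det_* g`, so that it is `1` on `SL_*(2, A)`. -/
lemma mem_SLStar_iff {g : (Matrix (Fin 2) (Fin 2) A)ˣ} :
    g ∈ SLStar A ↔ (g : Matrix (Fin 2) (Fin 2) A)ᴴ * J A * (g : Matrix (Fin 2) (Fin 2) A) = J A := by
  constructor
  · rintro ⟨⟨g, δ, hδ, hg⟩, hk, rfl⟩
    have h1 : starDet (g : Matrix (Fin 2) (Fin 2) A) = 1 := hk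
    rw [starDet_eq hδ hg] at h1
    rw [h1, one_smul] at hg
    exact hg
  · intro hg
    have h1 : IsCentralUnitSym A (1 : A) := ⟨one_mem _, isUnit_one, star_one A⟩
    have h2 : (g : Matrix (Fin 2) (Fin 2) A)ᴴ * J A * (g : Matrix (Fin 2) (Fin 2) A) =
        (1 : A) • J A := by rw [hg, one_smul]
    exact ⟨⟨g, 1, h1, h2⟩, starDet_eq h1 h2, rfl⟩

lemma entries_of_mem_SLStar {g : (Matrix (Fin 2) (Fin 2) A)ˣ} (hg : g ∈ SLStar A) :
    star (g.1 0 0) * g.1 1 0 = star (g.1 1 0) * g.1 0 0 ∧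
    star (g.1 0 0) * g.1 1 1 - star (g.1 1 0) * g.1 0 1 = 1 ∧
    star (g.1 1 1) * g.1 0 0 - star (g.1 0 1) * g.1 1 0 = 1 ∧
    star (g.1 0 1) * g.1 1 1 = star (g.1 1 1) * g.1 0 1 := by
  rw [mem_SLStar_iff] at hg
  have h00 := congrFun (congrFun hg 0) 0
  have h01 := congrFun (congrFun hg 0) 1
  have h10 := congrFun (congrFun hg 1) 0
  have h11 := congrFun (congrFun hg 1) 1
  simp only [J, Matrix.mul_apply, Fin.sum_univ_two, Matrix.conjTranspose_apply, Matrix.of_apply,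
    Matrix.cons_val', Matrix.cons_val_zero, Matrix.cons_val_one, Matrix.cons_val_fin_one,
    mul_zero, mul_one, zero_add, add_zero, mul_neg] at h00 h01 h10 h11
  refine ⟨?_, ?_, ?_, ?_⟩
  · rw [← sub_eq_zero, ← h00]; simp; abel
  · rw [← h01]; simp; abel
  · rw [← neg_inj, ← h10]; simp; abel
  · rw [← sub_eq_zero, ← h11]; simp; abel

lemma bruhatElements_subset_SLStar : bruhatElements A ⊆ SLStar A := by
  rintro g ((⟨a, rfl⟩ | ⟨b, hb, rfl⟩) | rfl) <;> rw [SetLike.mem_coe, mem_SLStar_iff] <;> ext i j <;>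
    fin_cases i <;> fin_cases j <;>
    simp [J, bruhatH, bruhatU, bruhatOmega, Matrix.mul_apply, Fin.sum_univ_two, *, ← star_mul]

/-- Gauss elimination: after scaling by some `h_a`, a matrix with invertible top left entry is a
product of a lower and an upper unitriangular matrix, and the lower one is conjugate to an upper one
under `ω`. -/
lemma mem_closure_of_isUnit {g : (Matrix (Fin 2) (Fin 2) A)ˣ} (hg : g ∈ SLStar A)
    (hu : IsUnit (g.1 0 0)) : g ∈ Subgroup.closure (bruhatElements A) := by
  have hH : ∀ a, bruhatH a ∈ Subgroup.closure (bruhatElements A) := fun a =>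
    Subgroup.subset_closure (Or.inl (Or.inl ⟨a, rfl⟩))
  have hU : ∀ b : A, star b = b → bruhatU b ∈ Subgroup.closure (bruhatElements A) := fun b hb =>
    Subgroup.subset_closure (Or.inl (Or.inr ⟨b, hb, rfl⟩))
  have hO : bruhatOmega A ∈ Subgroup.closure (bruhatElements A) :=
    Subgroup.subset_closure (Or.inr rfl)
  obtain ⟨u, hu⟩ := hu
  rw [← Subgroup.mul_mem_cancel_left _ (hH (star u⁻¹))]
  have hg2 : bruhatH (star u⁻¹) * g ∈ SLStar A :=
    mul_mem (bruhatElements_subset_SLStar (Or.inl (Or.inl ⟨_, rfl⟩))) hg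
  have h00 : (bruhatH (star u⁻¹) * g).1 0 0 = 1 := by
    simp [bruhatH, Matrix.mul_apply, Fin.sum_univ_two, ← hu]
  generalize bruhatH (star u⁻¹) * g = k at hg2 h00
  obtain ⟨h1, h2, -, h3⟩ := entries_of_mem_SLStar hg2
  rw [h00, star_one, one_mul, mul_one] at h1
  rw [h00, star_one, one_mul, ← h1, sub_eq_iff_eq_add] at h2
  rw [h2] at h3
  have h4 : star (k.1 0 1) = k.1 0 1 := by
    simpa [mul_add, add_mul, ← h1, mul_assoc] using h3
  have hk : k = (bruhatOmega A)⁻¹ * bruhatU (-k.1 1 0) * bruhatOmega A * bruhatU (k.1 0 1) := by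
    ext i j
    fin_cases i <;> fin_cases j <;>
      simp [bruhatU, bruhatOmega, Matrix.mul_apply, Fin.sum_univ_two, h00, h2, add_comm]
  rw [hk]
  exact mul_mem (mul_mem (mul_mem (inv_mem hO) (hU _ (by rw [star_neg, ← h1]))) hO) (hU _ h4)

theorem IsStarStable.closure_eq (h : IsStarStable A) :
    Subgroup.closure (bruhatElements A) = SLStar A := by
  refine le_antisymm ((Subgroup.closure_le _).mpr bruhatElements_subset_SLStar) fun g hg => ?_
  obtain ⟨h1, -, h2, -⟩ := entries_of_mem_SLStar hg
  obtain ⟨b, hb, hu⟩ := h (g.1 0 0) (g.1 1 0) ⟨h1, star (g.1 1 1), -star (g.1 0 1), by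
    rw [← h2, neg_mul, sub_eq_add_neg]⟩
  have hU : bruhatU b ∈ bruhatElements A := Or.inl (Or.inr ⟨b, hb, rfl⟩)
  rw [← Subgroup.mul_mem_cancel_left _ (Subgroup.subset_closure hU)]
  refine mem_closure_of_isUnit (mul_mem (bruhatElements_subset_SLStar hU) hg) ?_
  simpa [bruhatU, Matrix.mul_apply, Fin.sum_univ_two] using hu

lemma IsStarPair.map {B : Type*} [Ring B] [StarRing B] (f : A →+* B)
    (hf : ∀ x, f (star x) = star (f x)) {a c : A} (h : IsStarPair a c) :
    IsStarPair (f a) (f c) := by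
  obtain ⟨h, x, y, hxy⟩ := h
  refine ⟨?_, f x, f y, ?_⟩
  · rw [← hf, ← hf, ← map_mul, h, map_mul]
  · rw [← map_mul, ← map_mul, ← map_add, hxy, map_one]

lemma IsStarStable.of_ringEquiv {B : Type*} [Ring B] [StarRing B] (e : A ≃+* B)
    (he : ∀ x, e (star x) = star (e x)) (h : IsStarStable B) : IsStarStable A := by
  intro a c hac
  obtain ⟨b, hb, hu⟩ := h _ _ (hac.map (e : A →+* B) he)
  refine ⟨e.symm b, e.injective ?_, ?_⟩
  · rw [he, e.apply_symm_apply, hb]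
  · rw [← MulEquiv.isUnit_map e]
    simpa using hu

/-- The pair `(a, c)` may be replaced by `(p^{-*} a q, p c q)`. -/
lemma IsStarPair.units_mul {a c : A} (h : IsStarPair a c) (p q : Aˣ) :
    IsStarPair (star (↑p⁻¹ : A) * a * q) (p * c * q) := by
  obtain ⟨h, x, y, hxy⟩ := h
  refine ⟨?_, (↑q⁻¹ : A) * x * star (p : A), (↑q⁻¹ : A) * y * (↑p⁻¹ : A), ?_⟩
  · calc _ = star (q : A) * (star a * ((↑p⁻¹ : A) * p) * c) * q := by
          simp only [star_mul, star_star, mul_assoc]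
      _ = star (q : A) * (star c * star ((↑p⁻¹ : A) * p) * a) * q := by
          simp [h]
      _ = _ := by simp only [star_mul, mul_assoc]
  · calc _ = (↑q⁻¹ : A) * (x * star ((↑p⁻¹ : A) * p) * a + y * ((↑p⁻¹ : A) * p) * c) * q := by
          simp only [star_mul, mul_assoc, mul_add, add_mul]
      _ = 1 := by simp [hxy]

lemma exists_of_units_mul {a c : A} (p q : Aˣ)
    (h : ∃ b : A, star b = b ∧ IsUnit (star (↑p⁻¹ : A) * a * q + b * (p * c * q))) :
    ∃ b : A, star b = b ∧ IsUnit (a + b * c) := by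
  obtain ⟨b, hb, hu⟩ := h
  refine ⟨star (p : A) * b * p, by simp [hb, mul_assoc], ?_⟩
  have h1 : a + star (p : A) * b * p * c =
      ((star p : Aˣ) : A) * (star (↑p⁻¹ : A) * a * q + b * (p * c * q)) * (↑q⁻¹ : A) := by
    rw [Units.coe_star, mul_add, add_mul]
    congr 1
    · rw [← mul_assoc, ← mul_assoc, ← star_mul]; simp
    · simp [mul_assoc]
  rw [h1]
  exact ((star p).isUnit.mul hu).mul (q⁻¹).isUnit

end StarStable

/-! ### Block matrices and lifting of units -/

section Blocks

variable {R : Type*} [Ring R] {m n : Type*} [Fintype m] [Fintype n] [DecidableEq m] [DecidableEq n]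

/-- The Schur complement criterion over a noncommutative ring. -/
lemma isUnit_fromBlocks (A : Matrix m m R) (B : Matrix m n R) (C : Matrix n m R)
    (u : (Matrix n n R)ˣ) (h : IsUnit (A - B * (u⁻¹).1 * C)) :
    IsUnit (Matrix.fromBlocks A B C u.1) := by
  obtain ⟨s, hs⟩ := h
  have hl : ∀ X : Matrix m n R,
      IsUnit (Matrix.fromBlocks (1 : Matrix m m R) X 0 (1 : Matrix n n R)) := fun X =>
    ⟨⟨Matrix.fromBlocks 1 X 0 1, Matrix.fromBlocks 1 (-X) 0 1,
      by simp [Matrix.fromBlocks_multiply], by simp [Matrix.fromBlocks_multiply]⟩, rfl⟩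
  have hr : ∀ X : Matrix n m R,
      IsUnit (Matrix.fromBlocks (1 : Matrix m m R) 0 X (1 : Matrix n n R)) := fun X =>
    ⟨⟨Matrix.fromBlocks 1 0 X 1, Matrix.fromBlocks 1 0 (-X) 1,
      by simp [Matrix.fromBlocks_multiply], by simp [Matrix.fromBlocks_multiply]⟩, rfl⟩
  have hd : IsUnit (Matrix.fromBlocks s.1 0 0 u.1) :=
    ⟨⟨Matrix.fromBlocks s.1 0 0 u.1,
      Matrix.fromBlocks (s⁻¹).1 0 0 (u⁻¹).1,
      by simp [Matrix.fromBlocks_multiply], by simp [Matrix.fromBlocks_multiply]⟩, rfl⟩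
  have h1 := ((hl (B * (u⁻¹).1)).mul hd).mul (hr ((u⁻¹).1 * C))
  convert h1 using 1
  simp [Matrix.fromBlocks_multiply, hs, Matrix.mul_assoc]
  simp [← Matrix.mul_assoc]

/-- Clearing the first block row and column of a matrix whose top left block is invertible. -/
lemma exists_units_mul_eq_fromBlocks (u : (Matrix m m R)ˣ) (B : Matrix m n R) (C : Matrix n m R)
    (D : Matrix n n R) : ∃ (p q : (Matrix (m ⊕ n) (m ⊕ n) R)ˣ) (S : Matrix n n R),
    p.1 * Matrix.fromBlocks u.1 B C D * q.1 = Matrix.fromBlocks 1 0 0 S := by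
  refine ⟨⟨Matrix.fromBlocks (u⁻¹).1 0 (-C * (u⁻¹).1) 1,
      Matrix.fromBlocks u.1 0 C 1, ?_, ?_⟩,
    ⟨Matrix.fromBlocks 1 (-(u⁻¹).1 * B) 0 1,
      Matrix.fromBlocks 1 ((u⁻¹).1 * B) 0 1, ?_, ?_⟩,
    D - C * (u⁻¹).1 * B, ?_⟩
  · simp [Matrix.fromBlocks_multiply, Matrix.mul_assoc]
  · simp [Matrix.fromBlocks_multiply]
  · simp [Matrix.fromBlocks_multiply]
  · simp [Matrix.fromBlocks_multiply]
  · simp [Matrix.fromBlocks_multiply, Matrix.mul_assoc, sub_eq_neg_add]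

variable {S : Type*} [Ring S]

/-- If the elements congruent to `1` modulo the kernel of `φ` are invertible in `R`, the same holds
for matrices; no assumption on the image of `φ` is needed. -/
lemma isUnit_of_map_eq_one (φ : R →+* S) (h : ∀ x, φ x = 1 → IsUnit x) (k : ℕ)
    (X : Matrix (Fin k) (Fin k) R) (hX : φ.mapMatrix X = 1) : IsUnit X := by
  induction k with
  | zero => exact isUnit_of_subsingleton X
  | succ k ih =>
    let e : Fin (k + 1) ≃ Fin 1 ⊕ Fin k := Fintype.equivOfCardEq (by simp [add_comm])
    rw [← MulEquiv.isUnit_map (Matrix.reindexRingEquiv R e)]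
    set Y := Matrix.reindexRingEquiv R e X with hYdef
    have hY : φ.mapMatrix Y = 1 := by
      have : φ.mapMatrix Y = Matrix.reindexRingEquiv S e (φ.mapMatrix X) := by
        ext; simp [hYdef]
      rw [this, hX, map_one]
    rw [← Matrix.fromBlocks_toBlocks Y, ← Matrix.fromBlocks_one, RingHom.mapMatrix_apply,
      Matrix.fromBlocks_map, Matrix.fromBlocks_inj] at hY
    obtain ⟨hA, hB, hC, hD⟩ := hY
    obtain ⟨u, hu⟩ := ih _ hD
    rw [← Matrix.fromBlocks_toBlocks Y, ← hu]
    apply isUnit_fromBlocks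
    rw [← MulEquiv.isUnit_map Matrix.uniqueRingEquiv]
    apply h
    have h2 : (Y.toBlocks₁₁ - Y.toBlocks₁₂ * (u⁻¹).1 * Y.toBlocks₂₁).map φ = 1 := by
      rw [Matrix.map_sub _ (map_sub φ), Matrix.map_mul, Matrix.map_mul, hA, hB]
      simp
    simpa using congrFun (congrFun h2 0) 0

end Blocks

/-! ### Matrices over rings with a residue division ring -/

section Core

variable {R : Type*} [Ring R] [StarRing R]

lemma IsStarStable.reindex {m n : Type*} [Fintype m] [Fintype n] [DecidableEq m] [DecidableEq n]
    (e : m ≃ n) (h : IsStarStable (Matrix m m R)) : IsStarStable (Matrix n n R) :=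
  h.of_ringEquiv (Matrix.reindexRingEquiv R e.symm) fun x => by
    simp only [Matrix.coe_reindexRingEquiv, Matrix.star_eq_conjTranspose,
      Matrix.conjTranspose_reindex]

/-- The inductive step: if the top left block of `c` is invertible, then a star pair `(a, c)` is
reduced to a star pair of smaller size by clearing the first block row and column of `c`. -/
lemma exists_isUnit_add_mul_fromBlocks {m n : Type*} [Fintype m] [Fintype n] [DecidableEq m]
    [DecidableEq n] (h : IsStarStable (Matrix n n R)) (a c : Matrix (m ⊕ n) (m ⊕ n) R)
    (hac : IsStarPair a c) (hc : IsUnit c.toBlocks₁₁) :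
    ∃ b : Matrix (m ⊕ n) (m ⊕ n) R, star b = b ∧ IsUnit (a + b * c) := by
  obtain ⟨u, hu⟩ := hc
  obtain ⟨p, q, s, hpq⟩ := exists_units_mul_eq_fromBlocks u c.toBlocks₁₂ c.toBlocks₂₁ c.toBlocks₂₂
  rw [hu, Matrix.fromBlocks_toBlocks] at hpq
  refine exists_of_units_mul p q ?_
  have hac' := hac.units_mul p q
  rw [hpq] at hac' ⊢
  generalize star p⁻¹.1 * a * q.1 = d at hac' ⊢
  obtain ⟨a₁, a₂, a₃, a₄, rfl⟩ : ∃ a₁ a₂ a₃ a₄, d = Matrix.fromBlocks a₁ a₂ a₃ a₄ :=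
    ⟨_, _, _, _, (Matrix.fromBlocks_toBlocks d).symm⟩
  obtain ⟨h1, x, y, h2⟩ := hac'
  rw [Matrix.star_eq_conjTranspose, Matrix.star_eq_conjTranspose, Matrix.fromBlocks_conjTranspose,
    Matrix.fromBlocks_conjTranspose, Matrix.fromBlocks_multiply, Matrix.fromBlocks_multiply,
    Matrix.fromBlocks_inj] at h1
  simp only [Matrix.mul_one, Matrix.mul_zero, add_zero, zero_add, Matrix.conjTranspose_one,
    Matrix.conjTranspose_zero, Matrix.one_mul, Matrix.zero_mul] at h1
  obtain ⟨h11, h12, -, h22⟩ := h1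
  rw [← Matrix.fromBlocks_toBlocks x, ← Matrix.fromBlocks_toBlocks y, Matrix.fromBlocks_multiply,
    Matrix.fromBlocks_multiply, Matrix.fromBlocks_add, ← Matrix.fromBlocks_one,
    Matrix.fromBlocks_inj] at h2
  obtain ⟨-, -, -, h2⟩ := h2
  obtain ⟨b, hb, v, hv⟩ := h a₄ s ⟨h22, x.toBlocks₂₂, x.toBlocks₂₁ * a₃ᴴ + y.toBlocks₂₂, by
    rw [← h2, ← h12, Matrix.mul_zero, zero_add, add_mul, Matrix.mul_assoc]; abel⟩
  -- `s v⁻¹` is symmetric because `(a₄ + b s)^* s` is.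
  have hvs : star v.1 * s = star s * v.1 := by
    rw [hv, star_add, star_mul, hb, add_mul, mul_add, ← mul_assoc]
    congr 1
  have hsv : star (s * (v⁻¹).1) = s * (v⁻¹).1 := by
    calc star (s * (v⁻¹).1) = star (v⁻¹).1 * (star s * v.1) * (v⁻¹).1 := by
          rw [star_mul, ← mul_assoc, mul_assoc _ v.1, Units.mul_inv, mul_one]
      _ = star (v.1 * (v⁻¹).1) * s * (v⁻¹).1 := by rw [← hvs, star_mul, ← mul_assoc]
      _ = _ := by rw [Units.mul_inv, star_one, one_mul]
  -- The first diagonal block is chosen so that the Schur complement of `v` becomes `1`.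
  refine ⟨Matrix.fromBlocks (1 - a₁ + a₃ᴴ * (s * (v⁻¹).1) * a₃) 0 0 b, ?_, ?_⟩
  · rw [Matrix.star_eq_conjTranspose, Matrix.fromBlocks_conjTranspose]
    rw [Matrix.star_eq_conjTranspose] at hb hsv
    rw [Matrix.conjTranspose_add, Matrix.conjTranspose_sub, Matrix.conjTranspose_one, h11,
      Matrix.conjTranspose_mul _ a₃, Matrix.conjTranspose_mul, hsv,
      Matrix.conjTranspose_conjTranspose, Matrix.conjTranspose_zero, hb]
    simp [Matrix.mul_assoc]
  · rw [Matrix.fromBlocks_multiply, Matrix.fromBlocks_add]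
    simp only [Matrix.mul_one, Matrix.mul_zero, Matrix.zero_mul, add_zero, zero_add, ← hv]
    apply isUnit_fromBlocks
    rw [← h12, Matrix.mul_assoc a₃ᴴ s]
    convert isUnit_one (M := Matrix m m R) using 1
    abel

variable {D : Type*} [DivisionRing D] (f : R →+* D)

/-- The maps `f` and `f ∘ *` form a homomorphism `R → D × Dᵐᵒᵖ`, and every element of `R` over `1`
is invertible. -/
lemma isUnit_matrix_of_map_eq_one (hu : ∀ x, f x ≠ 0 → f (star x) ≠ 0 → IsUnit x) {n : ℕ}
    {X : Matrix (Fin n) (Fin n) R} (h1 : f.mapMatrix X = 1) (h2 : f.mapMatrix Xᴴ = 1) :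
    IsUnit X := by
  let g : R →+* Dᵐᵒᵖ := (RingHom.op f).comp (starRingEquiv : R ≃+* Rᵐᵒᵖ).toRingHom
  have hg : ∀ x, g x = MulOpposite.op (f (star x)) := fun _ => rfl
  refine isUnit_of_map_eq_one (f.prod g) (fun x hx => ?_) n X ?_
  · rw [RingHom.prod_apply, Prod.mk_eq_one, hg, MulOpposite.op_eq_one_iff] at hx
    exact hu x (by simp [hx.1]) (by simp [hx.2])
  · ext i j
    · have := congrFun (congrFun h1 i) j
      rw [RingHom.mapMatrix_apply, Matrix.map_apply] at this ⊢
      rw [RingHom.prod_apply, this, Matrix.one_apply, Matrix.one_apply]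
      split_ifs <;> rfl
    · have := congrFun (congrFun h2 j) i
      rw [RingHom.mapMatrix_apply, Matrix.map_apply, Matrix.conjTranspose_apply] at this
      rw [RingHom.mapMatrix_apply, Matrix.map_apply, RingHom.prod_apply, hg, this,
        Matrix.one_apply, Matrix.one_apply]
      simp only [eq_comm (a := j)]
      split_ifs <;> rfl

/-- A star pair whose second entry vanishes under `f` and under `f ∘ *` has an invertible first
entry. -/
lemma IsStarPair.isUnit_of_map_eq_zero
    (hu : ∀ x, f x ≠ 0 → f (star x) ≠ 0 → IsUnit x) {n : ℕ} {a c : Matrix (Fin n) (Fin n) R}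
    (hac : IsStarPair a c) (h1 : f.mapMatrix c = 0) (h2 : f.mapMatrix cᴴ = 0) : IsUnit a := by
  obtain ⟨-, x, y, hxy⟩ := hac
  have hxy' : star a * star x + star c * star y = 1 := by
    rw [← star_mul, ← star_mul, ← star_add, hxy, star_one]
  have e1 : f.mapMatrix (x * a) = 1 := by
    rw [← map_one f.mapMatrix, ← hxy, map_add, map_mul _ y, h1, mul_zero, add_zero]
  have e2 : f.mapMatrix (x * a)ᴴ = 1 := by
    rw [← map_one f.mapMatrix, ← hxy', map_add, map_mul _ (star c), Matrix.star_eq_conjTranspose c,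
      h2, zero_mul, add_zero, ← star_mul, Matrix.star_eq_conjTranspose]
  have e3 : f.mapMatrix (a * x) = 1 := by
    rw [map_mul] at e1 ⊢; exact mul_eq_one_comm.mp e1
  have e4 : f.mapMatrix (a * x)ᴴ = 1 := by
    rw [Matrix.conjTranspose_mul, map_mul] at e2 ⊢; exact mul_eq_one_comm.mp e2
  obtain ⟨u, hu1⟩ := isUnit_matrix_of_map_eq_one f hu e1 e2
  obtain ⟨v, hv1⟩ := isUnit_matrix_of_map_eq_one f hu e3 e4
  refine isUnit_iff_exists_and_exists.mpr ⟨⟨x * (v⁻¹).1, ?_⟩, (u⁻¹).1 * x, ?_⟩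
  · rw [← mul_assoc, ← hv1, Units.mul_inv]
  · rw [mul_assoc, ← hu1, Units.inv_mul]

/-- If `f(c) = 0`, then `f(a)` is a left, hence two-sided, inverse of a matrix, and `c^* a = a^* c`
forces `f(c^*) = 0`. The converse is similar. -/
lemma IsStarPair.map_eq_zero_iff {n : ℕ} {a c : Matrix (Fin n) (Fin n) R}
    (hac : IsStarPair a c) : f.mapMatrix c = 0 ↔ f.mapMatrix cᴴ = 0 := by
  obtain ⟨h, x, y, hxy⟩ := hac
  have hxy' : star a * star x + star c * star y = 1 := by
    rw [← star_mul, ← star_mul, ← star_add, hxy, star_one]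
  have h' := congrArg f.mapMatrix h
  rw [map_mul, map_mul] at h'
  rw [← Matrix.star_eq_conjTranspose]
  constructor <;> intro h0
  · have e1 : f.mapMatrix x * f.mapMatrix a = 1 := by
      rw [← map_one f.mapMatrix, ← hxy, map_add, map_mul, map_mul _ y, h0, mul_zero, add_zero]
    rw [h0, mul_zero] at h'
    calc f.mapMatrix (star c) = f.mapMatrix (star c) * (f.mapMatrix a * f.mapMatrix x) := by
          rw [mul_eq_one_comm.mp e1, mul_one]
      _ = 0 := by rw [← mul_assoc, ← h', zero_mul]
  · have e1 : f.mapMatrix (star a) * f.mapMatrix (star x) = 1 := by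
      rw [← map_one f.mapMatrix, ← hxy', map_add, map_mul, map_mul _ (star c), h0, zero_mul,
        add_zero]
    rw [h0, zero_mul] at h'
    calc f.mapMatrix c = (f.mapMatrix (star x) * f.mapMatrix (star a)) * f.mapMatrix c := by
          rw [mul_eq_one_comm.mp e1, one_mul]
      _ = 0 := by rw [mul_assoc, h', mul_zero]

/-- Two permutation matrices can be glued to an invertible matrix over `R` which maps to the first
one under `f` and to the second one under `f ∘ *`, provided that they are equal or the kernel of `f`
is not stable under the involution. -/
lemma exists_unit_glue (hu : ∀ x, f x ≠ 0 → f (star x) ≠ 0 → IsUnit x) {n : ℕ}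
    {σ τ : Equiv.Perm (Fin n)} (h : σ = τ ∨ ∃ e : R, f e = 1 ∧ f (star e) = 0) :
    ∃ p : (Matrix (Fin n) (Fin n) R)ˣ, f.mapMatrix p.1 = σ.permMatrix D ∧
      f.mapMatrix p.1ᴴ = τ⁻¹.permMatrix D := by
  rcases h with rfl | ⟨e, h1, h2⟩
  · refine ⟨⟨σ.permMatrix R, σ⁻¹.permMatrix R, ?_, ?_⟩, ?_, ?_⟩
    · rw [← Matrix.permMatrix_mul]; simp
    · rw [← Matrix.permMatrix_mul]; simp
    · ext i j
      simp [Equiv.Perm.permMatrix, PEquiv.toMatrix_apply, apply_ite f]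
    · ext i j
      simp [Equiv.Perm.permMatrix, PEquiv.toMatrix_apply, apply_ite f,
        Equiv.symm_apply_eq, eq_comm (a := i)]
  -- `P σ τ` has the required images; it is invertible because `P σ τ * P σ⁻¹ τ⁻¹` lies over `1`.
  let P : Equiv.Perm (Fin n) → Equiv.Perm (Fin n) → Matrix (Fin n) (Fin n) R := fun σ τ =>
    e • σ.permMatrix R + (1 - e) • τ.permMatrix R
  have hP1 : ∀ σ τ, f.mapMatrix (P σ τ) = σ.permMatrix D := by
    intro σ τ
    ext i j
    simp [P, h1, Equiv.Perm.permMatrix, PEquiv.toMatrix_apply, apply_ite f]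
  have hP2 : ∀ σ τ, f.mapMatrix (P σ τ)ᴴ = τ⁻¹.permMatrix D := by
    intro σ τ
    ext i j
    simp [P, h2, Equiv.Perm.permMatrix, PEquiv.toMatrix_apply, apply_ite f,
      Equiv.symm_apply_eq, eq_comm (a := i)]
  have key : ∀ σ τ, IsUnit (P σ τ * P σ⁻¹ τ⁻¹) := by
    intro σ τ
    apply isUnit_matrix_of_map_eq_one f hu
    · rw [map_mul, hP1, hP1, ← Matrix.permMatrix_mul]
      simp
    · rw [Matrix.conjTranspose_mul, map_mul, hP2, hP2, ← Matrix.permMatrix_mul]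
      simp
  obtain ⟨u, hu1⟩ := key σ τ
  obtain ⟨v, hv1⟩ := key σ⁻¹ τ⁻¹
  rw [inv_inv, inv_inv] at hv1
  obtain ⟨p, hp⟩ : IsUnit (P σ τ) := isUnit_iff_exists_and_exists.mpr
    ⟨⟨P σ⁻¹ τ⁻¹ * (u⁻¹).1, by rw [← mul_assoc, ← hu1, Units.mul_inv]⟩,
      (v⁻¹).1 * P σ⁻¹ τ⁻¹, by rw [mul_assoc, ← hv1, Units.inv_mul]⟩
  exact ⟨p, by rw [hp, hP1], by rw [hp, hP2]⟩

/-- A matrix which vanishes neither under `f` nor under `f ∘ *` is equivalent to a matrix with an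
invertible entry, at any given place `o` of the diagonal. -/
lemma exists_units_isUnit_entry (hf : Function.Surjective f)
    (hu : ∀ x, f x ≠ 0 → f (star x) ≠ 0 → IsUnit x) {n : ℕ} (o : Fin n)
    {c : Matrix (Fin n) (Fin n) R} (h1 : f.mapMatrix c ≠ 0) (h2 : f.mapMatrix cᴴ ≠ 0) :
    ∃ p q : (Matrix (Fin n) (Fin n) R)ˣ, IsUnit ((p.1 * c * q.1) o o) := by
  obtain ⟨i, j, hij⟩ : ∃ i j, f (c i j) ≠ 0 := by
    by_contra! hcon; exact h1 (by ext i j; exact hcon i j)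
  obtain ⟨k, l, hkl, hglue⟩ : ∃ k l, f (star (c k l)) ≠ 0 ∧
      ((k = i ∧ l = j) ∨ ∃ e : R, f e = 1 ∧ f (star e) = 0) := by
    -- If `ker f` is stable under the involution, the entry `(i, j)` serves for `f ∘ *` as well.
    by_cases hst : ∃ m, f m ≠ 0 ∧ f (star m) = 0
    · obtain ⟨k, l, hkl⟩ : ∃ k l, f (star (c k l)) ≠ 0 := by
        by_contra! hcon; exact h2 (by ext i j; exact hcon j i)
      obtain ⟨m, hm, hm'⟩ := hst
      obtain ⟨r, hr⟩ := hf (f m)⁻¹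
      exact ⟨k, l, hkl, Or.inr ⟨r * m, by rw [map_mul, hr, inv_mul_cancel₀ hm],
        by rw [star_mul, map_mul, hm', zero_mul]⟩⟩
    · push Not at hst
      exact ⟨i, j, hst _ hij, Or.inl ⟨rfl, rfl⟩⟩
  obtain ⟨p, hp, hp'⟩ := exists_unit_glue f hu (σ := Equiv.swap o i) (τ := Equiv.swap o k)
    (hglue.imp_left fun h => by rw [h.1])
  obtain ⟨q, hq, hq'⟩ := exists_unit_glue f hu (σ := Equiv.swap o j) (τ := Equiv.swap o l)
    (hglue.imp_left fun h => by rw [h.2])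
  refine ⟨p, q, hu _ ?_ ?_⟩
  · have : f ((p.1 * c * q.1) o o) = f (c i j) := by
      change f.mapMatrix (p.1 * c * q.1) o o = _
      rw [map_mul, map_mul, hp, hq]
      simp [Equiv.Perm.permMatrix, PEquiv.toMatrix_toPEquiv_mul, PEquiv.mul_toMatrix_toPEquiv]
    rwa [this]
  · have : f (star ((p.1 * c * q.1) o o)) = f (star (c k l)) := by
      change f.mapMatrix (p.1 * c * q.1)ᴴ o o = _
      rw [Matrix.conjTranspose_mul, Matrix.conjTranspose_mul, map_mul, map_mul, hp', hq']
      simp [Equiv.Perm.permMatrix, PEquiv.toMatrix_toPEquiv_mul, PEquiv.mul_toMatrix_toPEquiv]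
    rwa [this]

/-- The stable range condition for matrices over a ring `R` with involution which has a residue
division ring `D` such that the elements mapping to nonzero elements under `f` and under `f ∘ *` are
invertible. The kernel of `f` need not be stable under the involution. -/
theorem isStarStable_matrix (hf : Function.Surjective f)
    (hu : ∀ x, f x ≠ 0 → f (star x) ≠ 0 → IsUnit x) (n : ℕ) :
    IsStarStable (Matrix (Fin n) (Fin n) R) := by
  induction n with
  | zero => exact fun _ _ _ => ⟨0, star_zero _, isUnit_of_subsingleton _⟩
  | succ n ih =>
    intro a c hac
    by_cases h1 : f.mapMatrix c = 0
    · exact ⟨0, star_zero _, by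
        simpa using hac.isUnit_of_map_eq_zero f hu h1 ((hac.map_eq_zero_iff f).mp h1)⟩
    let e : Fin (n + 1) ≃ Fin 1 ⊕ Fin n := Fintype.equivOfCardEq (by simp [add_comm])
    obtain ⟨p, q, hpq⟩ := exists_units_isUnit_entry f hf hu (e.symm (Sum.inl 0)) h1
      (mt (hac.map_eq_zero_iff f).mpr h1)
    refine exists_of_units_mul p q ?_
    have hac' := hac.units_mul p q
    generalize star p⁻¹.1 * a * q.1 = a at hac'
    generalize p.1 * c * q.1 = c at hac' hpq
    have hstar : ∀ x, Matrix.reindexRingEquiv R e (star x) = star (Matrix.reindexRingEquiv R e x) :=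
      fun x => by simp only [Matrix.coe_reindexRingEquiv, Matrix.star_eq_conjTranspose,
        Matrix.conjTranspose_reindex]
    obtain ⟨b, hb, hu'⟩ := exists_isUnit_add_mul_fromBlocks ih _ _
      (hac'.map (Matrix.reindexRingEquiv R e).toRingHom hstar) (by
        rw [← MulEquiv.isUnit_map Matrix.uniqueRingEquiv]
        exact hpq)
    refine ⟨(Matrix.reindexRingEquiv R e).symm b, (Matrix.reindexRingEquiv R e).injective ?_, ?_⟩
    · rw [hstar, RingEquiv.apply_symm_apply, hb]
    · rw [← MulEquiv.isUnit_map (Matrix.reindexRingEquiv R e)]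
      rwa [map_add, map_mul, RingEquiv.apply_symm_apply]

/-! ### `*`-local rings -/

/-- The two-sided ideal `I^*`. -/
def starIdeal (I : Ideal R) [I.IsTwoSided] : Ideal R where
  carrier := {x | star x ∈ I}
  add_mem' {x y} hx hy := by
    change star (x + y) ∈ I
    rw [star_add]; exact add_mem hx hy
  zero_mem' := by
    change star (0 : R) ∈ I
    rw [star_zero]; exact zero_mem I
  smul_mem' r x hx := by
    change star (r * x) ∈ I
    rw [star_mul]; exact I.mul_mem_right _ hx

lemma mem_starIdeal {I : Ideal R} [I.IsTwoSided] {x : R} : x ∈ starIdeal I ↔ star x ∈ I := Iff.rfl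

instance (I : Ideal R) [I.IsTwoSided] : (starIdeal I).IsTwoSided :=
  ⟨fun {a} b ha => by
    rw [mem_starIdeal, star_mul]; exact I.mul_mem_left _ ha⟩

lemma IsStableIdeal.star_mem {K : Ideal R} (hK : IsStableIdeal K) {x : R} (hx : x ∈ K) :
    star x ∈ K := by
  have : star x ∈ star '' (K : Set R) := ⟨x, hx, rfl⟩
  rwa [hK.2] at this

lemma isStableIdeal_inf_starIdeal (I : Ideal R) [I.IsTwoSided] :
    IsStableIdeal (I ⊓ starIdeal I) := by
  refine ⟨⟨fun {a} b ha => ⟨I.mul_mem_right _ ha.1, (starIdeal I).mul_mem_right _ ha.2⟩⟩, ?_⟩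
  ext x
  constructor
  · rintro ⟨y, ⟨hy1, hy2⟩, rfl⟩
    exact ⟨hy2, by rw [SetLike.mem_coe, mem_starIdeal, star_star]; exact hy1⟩
  · rintro ⟨hx1, hx2⟩
    exact ⟨star x, ⟨hx2, by rw [SetLike.mem_coe, mem_starIdeal, star_star]; exact hx1⟩, star_star x⟩

/-- Since `M * M^*` and `M^* * M` lie in `M ∩ M^*`, a maximal ideal over this intersection contains
`M` or `M^*`. -/
lemma eq_or_eq_starIdeal_of_inf_le {M M' : Ideal R} [M.IsTwoSided] [M'.IsTwoSided]
    (hM : M.IsMaximal) (hM' : M'.IsMaximal) (h : M ⊓ starIdeal M ≤ M') :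
    M' = M ∨ M' = starIdeal M := by
  by_cases hle : M ≤ M'
  · exact Or.inl (hM.eq_of_le hM'.ne_top hle).symm
  right
  have hle' : starIdeal M ≤ M' := by
    obtain ⟨y, hy, hy'⟩ := SetLike.not_le_iff_exists.mp hle
    intro x hx
    by_contra hx'
    let := Ideal.Quotient.divisionRing M'
    have h0 : Ideal.Quotient.mk M' (y * x) = 0 := Ideal.Quotient.eq_zero_iff_mem.mpr
      (h ⟨M.mul_mem_right _ hy, (starIdeal M).mul_mem_left _ hx⟩)
    rw [map_mul, mul_eq_zero, Ideal.Quotient.eq_zero_iff_mem, Ideal.Quotient.eq_zero_iff_mem] at h0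
    exact h0.elim hy' hx'
  have htop : starIdeal M' ≠ ⊤ := by
    rw [Ideal.ne_top_iff_one, mem_starIdeal, star_one, ← Ideal.ne_top_iff_one]
    exact hM'.ne_top
  have heq : M = starIdeal M' := hM.eq_of_le htop fun x hx => by
    rw [mem_starIdeal]
    exact hle' (by rwa [mem_starIdeal, star_star])
  refine le_antisymm (fun x hx => ?_) hle'
  rw [mem_starIdeal, heq, mem_starIdeal, star_star]
  exact hx

/-- If `M` is a maximal left ideal of a `*`-local ring, then `M ∩ M^*` is the stable maximal
ideal, so that `M` and `M^*` are the only maximal left ideals. -/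
lemma IsStarLocalRing.isUnit (h : IsStarLocalRing R) {M : Ideal R} (hM : M.IsMaximal) {x : R}
    (h1 : x ∉ M) (h2 : star x ∉ M) : IsUnit x := by
  have hmax : ∀ (N : Ideal R) [N.IsTwoSided], N.IsMaximal →
      Maximal (fun K : Ideal R => K ≠ ⊤ ∧ IsStableIdeal K) (N ⊓ starIdeal N) := by
    intro N _ hN
    refine ⟨⟨ne_top_of_le_ne_top hN.ne_top inf_le_left, isStableIdeal_inf_starIdeal N⟩, ?_⟩
    rintro K ⟨hK, hKs⟩ hle
    obtain ⟨N', hN', hKN⟩ := Ideal.exists_le_maximal K hK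
    have := h.lMaximal N' hN'
    rcases eq_or_eq_starIdeal_of_inf_le hN hN' (hle.trans hKN) with rfl | rfl
    · exact fun y hy => ⟨hKN hy, hKN (hKs.star_mem hy)⟩
    · refine fun y hy => ⟨?_, hKN hy⟩
      have := hKN (hKs.star_mem hy)
      rwa [mem_starIdeal, star_star] at this
  have := h.lMaximal M hM
  have hleft : ∀ y : R, y ∉ M → star y ∉ M → ∃ z, z * y = 1 := by
    intro y hy1 hy2
    by_contra! hcon
    obtain ⟨M', hM', hyM⟩ := Ideal.exists_le_maximal (Ideal.span {y}) (by
      rw [Ideal.ne_top_iff_one, Ideal.mem_span_singleton']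
      exact fun ⟨z, hz⟩ => hcon z hz)
    have hyM : y ∈ M' := hyM (Ideal.mem_span_singleton_self y)
    have := h.lMaximal M' hM'
    have heq := h.existsUnique_stableMaximal.unique (hmax M hM) (hmax M' hM')
    rcases eq_or_eq_starIdeal_of_inf_le hM hM' (heq.le.trans inf_le_left) with rfl | rfl
    · exact hy1 hyM
    · exact hy2 hyM
  obtain ⟨z, hz⟩ := hleft x h1 h2
  obtain ⟨w, hw⟩ := hleft z
    (fun hzM => hM.ne_top (M.eq_top_iff_one.mpr (hz ▸ M.mul_mem_right _ hzM)))
    (fun hzM => hM.ne_top (M.eq_top_iff_one.mpr (by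
      rw [← star_one, ← hz, star_mul]; exact M.mul_mem_left _ hzM)))
  exact isUnit_iff_exists_and_exists.mpr
    ⟨⟨z, by rw [← left_inv_eq_right_inv hw hz, hw]⟩, z, hz⟩

theorem IsStarLocalRing.isStarStable (h : IsStarLocalRing R) (n : ℕ) :
    IsStarStable (Matrix (Fin n) (Fin n) R) := by
  have : Nontrivial R := by
    obtain ⟨I, hI, -⟩ := h.existsUnique_stableMaximal
    by_contra hcon
    rw [not_nontrivial_iff_subsingleton] at hcon
    exact hI.1.1 (Subsingleton.elim _ _)
  obtain ⟨M, hM⟩ := Ideal.exists_maximal R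
  have := h.lMaximal M hM
  let := Ideal.Quotient.divisionRing M
  refine isStarStable_matrix (Ideal.Quotient.mk M) Ideal.Quotient.mk_surjective
    (fun x h1 h2 => h.isUnit hM ?_ ?_) n
  · rwa [Ne, Ideal.Quotient.eq_zero_iff_mem] at h1
  · rwa [Ne, Ideal.Quotient.eq_zero_iff_mem] at h2

end Core

/-! ### Passage from local to global rings -/

section LocalGlobal

/-- The stable range condition for matrices of size `n` over `A` with entries in a subring `S`; the
symmetric matrix and the inverse have to have entries in `S` too. -/
def IsStarStableOn {B : Type*} [Ring B] [StarRing B] (S : Subring B) (n : ℕ) : Prop :=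
  ∀ a c x y : Matrix (Fin n) (Fin n) B, (∀ i j, a i j ∈ S) → (∀ i j, c i j ∈ S) →
    (∀ i j, x i j ∈ S) → (∀ i j, y i j ∈ S) → star a * c = star c * a → x * a + y * c = 1 →
    ∃ b u : Matrix (Fin n) (Fin n) B, (∀ i j, b i j ∈ S) ∧ (∀ i j, u i j ∈ S) ∧ star b = b ∧
      (a + b * c) * u = 1 ∧ u * (a + b * c) = 1

lemma star_mapMatrix {T B : Type*} [Ring T] [StarRing T] [Ring B] [StarRing B] (f : T →+* B)
    (hf : ∀ t, f (star t) = star (f t)) {n : ℕ} (X : Matrix (Fin n) (Fin n) T) :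
    f.mapMatrix (star X) = star (f.mapMatrix X) := by
  ext i j
  simp [Matrix.star_eq_conjTranspose, hf]

lemma IsStarStable.matrix_of_ringEquiv {A B : Type*} [Ring A] [StarRing A] [Ring B] [StarRing B]
    (e : A ≃+* B) (he : ∀ x, e (star x) = star (e x)) {n : ℕ}
    (h : IsStarStable (Matrix (Fin n) (Fin n) B)) : IsStarStable (Matrix (Fin n) (Fin n) A) :=
  h.of_ringEquiv e.mapMatrix fun x => star_mapMatrix (e : A →+* B) he x

/-- The condition `IsStarStableOn S` may be checked on a ring with involution identified with `S`. -/
lemma IsStarStable.isStarStableOn {T B : Type*} [Ring T] [StarRing T] [Ring B] [StarRing B]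
    (f : T →+* B) (hf : ∀ t, f (star t) = star (f t)) (hinj : Function.Injective f) {n : ℕ}
    (h : IsStarStable (Matrix (Fin n) (Fin n) T)) {S : Subring B} (hS : f.range = S) :
    IsStarStableOn S n := by
  subst hS
  have hlift : ∀ X : Matrix (Fin n) (Fin n) B, (∀ i j, X i j ∈ f.range) →
      ∃ X', f.mapMatrix X' = X := by
    intro X hX
    choose X' hX' using hX
    exact ⟨Matrix.of X', by ext i j; exact hX' i j⟩
  have hinj' : Function.Injective (f.mapMatrix (m := Fin n)) := Matrix.map_injective hinj
  intro a c x y ha hc hx hy h1 h2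
  obtain ⟨a, rfl⟩ := hlift a ha
  obtain ⟨c, rfl⟩ := hlift c hc
  obtain ⟨x, rfl⟩ := hlift x hx
  obtain ⟨y, rfl⟩ := hlift y hy
  obtain ⟨b, hb, u, hu⟩ := h a c ⟨hinj' (by
      rw [map_mul, map_mul, star_mapMatrix f hf, star_mapMatrix f hf, h1]),
    x, y, hinj' (by rw [map_add, map_mul, map_mul, h2, map_one])⟩
  refine ⟨f.mapMatrix b, f.mapMatrix (u⁻¹).1, fun i j => ⟨_, rfl⟩, fun i j => ⟨_, rfl⟩, ?_, ?_, ?_⟩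
  · rw [← star_mapMatrix f hf, hb]
  · rw [← map_mul, ← map_add, ← map_mul, ← hu, Units.mul_inv, map_one]
  · rw [← map_mul, ← map_add, ← map_mul, ← hu, Units.inv_mul, map_one]

/-- The stable range condition for a restricted product of rings with involution, presented by its
projections `φ v` to the factors `B v`. -/
theorem isStarStable_matrix_of_local {A V : Type*} [Ring A] [StarRing A] {B : V → Type*}
    [∀ v, Ring (B v)] [∀ v, StarRing (B v)] (S : ∀ v, Subring (B v)) (φ : ∀ v, A →+* B v)
    (hstar : ∀ v x, φ v (star x) = star (φ v x))
    (hinj : ∀ x y, (∀ v, φ v x = φ v y) → x = y)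
    (hglue : ∀ β : ∀ v, B v, (∀ᶠ v in Filter.cofinite, β v ∈ S v) → ∃ α, ∀ v, φ v α = β v)
    (hfin : ∀ α, ∀ᶠ v in Filter.cofinite, φ v α ∈ S v) {n : ℕ}
    (hB : ∀ v, IsStarStable (Matrix (Fin n) (Fin n) (B v)))
    (hS : ∀ᶠ v in Filter.cofinite, IsStarStableOn (S v) n) :
    IsStarStable (Matrix (Fin n) (Fin n) A) := by
  rintro a c ⟨hac, x, y, hxy⟩
  have hfin' : ∀ X : Matrix (Fin n) (Fin n) A,
      ∀ᶠ v in Filter.cofinite, ∀ i j, (φ v).mapMatrix X i j ∈ S v := fun X => by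
    simp only [Filter.eventually_all]
    exact fun i j => hfin (X i j)
  have hloc : ∀ v, ∃ b u : Matrix (Fin n) (Fin n) (B v), star b = b ∧
      ((φ v).mapMatrix a + b * (φ v).mapMatrix c) * u = 1 ∧
      u * ((φ v).mapMatrix a + b * (φ v).mapMatrix c) = 1 ∧
      ((IsStarStableOn (S v) n ∧ (∀ i j, (φ v).mapMatrix a i j ∈ S v) ∧
        (∀ i j, (φ v).mapMatrix c i j ∈ S v) ∧ (∀ i j, (φ v).mapMatrix x i j ∈ S v) ∧
        (∀ i j, (φ v).mapMatrix y i j ∈ S v)) → (∀ i j, b i j ∈ S v) ∧ (∀ i j, u i j ∈ S v)) := by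
    intro v
    have h1 : star ((φ v).mapMatrix a) * (φ v).mapMatrix c =
        star ((φ v).mapMatrix c) * (φ v).mapMatrix a := by
      rw [← star_mapMatrix _ (hstar v), ← star_mapMatrix _ (hstar v), ← map_mul, hac, map_mul]
    have h2 : (φ v).mapMatrix x * (φ v).mapMatrix a + (φ v).mapMatrix y * (φ v).mapMatrix c = 1 := by
      rw [← map_mul, ← map_mul, ← map_add, hxy, map_one]
    by_cases hv : IsStarStableOn (S v) n ∧ (∀ i j, (φ v).mapMatrix a i j ∈ S v) ∧
        (∀ i j, (φ v).mapMatrix c i j ∈ S v) ∧ (∀ i j, (φ v).mapMatrix x i j ∈ S v) ∧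
        (∀ i j, (φ v).mapMatrix y i j ∈ S v)
    · obtain ⟨b, u, hb, hu, h⟩ := hv.1 _ _ _ _ hv.2.1 hv.2.2.1 hv.2.2.2.1 hv.2.2.2.2 h1 h2
      exact ⟨b, u, h.1, h.2.1, h.2.2, fun _ => ⟨hb, hu⟩⟩
    · obtain ⟨b, hb, u, hu⟩ := hB v _ _ ⟨h1, _, _, h2⟩
      exact ⟨b, (u⁻¹).1, hb, by rw [← hu, Units.mul_inv], by rw [← hu, Units.inv_mul],
        fun h => absurd h hv⟩
  choose b u hb hbu hub hint using hloc
  have hint' : ∀ᶠ v in Filter.cofinite, (∀ i j, b v i j ∈ S v) ∧ (∀ i j, u v i j ∈ S v) := by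
    filter_upwards [hS, hfin' a, hfin' c, hfin' x, hfin' y] with v h1 h2 h3 h4 h5
    exact hint v ⟨h1, h2, h3, h4, h5⟩
  have hglue' : ∀ β : ∀ v, Matrix (Fin n) (Fin n) (B v),
      (∀ᶠ v in Filter.cofinite, ∀ i j, β v i j ∈ S v) → ∃ α, ∀ v, (φ v).mapMatrix α = β v := by
    intro β hβ
    choose α hα using fun i j => hglue (fun v => β v i j) (hβ.mono fun v h => h i j)
    exact ⟨Matrix.of α, fun v => by ext i j; exact hα i j v⟩
  have hinj' : ∀ X Y : Matrix (Fin n) (Fin n) A,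
      (∀ v, (φ v).mapMatrix X = (φ v).mapMatrix Y) → X = Y := fun X Y h => by
    ext i j
    exact hinj _ _ fun v => congrFun (congrFun (h v) i) j
  obtain ⟨b', hb'⟩ := hglue' b (hint'.mono fun v h => h.1)
  obtain ⟨u', hu'⟩ := hglue' u (hint'.mono fun v h => h.2)
  refine ⟨b', hinj' _ _ fun v => ?_, isUnit_iff_exists.mpr ⟨u', hinj' _ _ fun v => ?_,
    hinj' _ _ fun v => ?_⟩⟩
  · rw [star_mapMatrix _ (hstar v), hb', hb]
  · rw [map_mul, map_add, map_mul, hb', hu', hbu, map_one]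
  · rw [map_mul, map_add, map_mul, hb', hu', hub, map_one]

end LocalGlobal

/-! ### Adeles with a Galois involution -/

section GaloisAdeles

variable {E : Type*} [Field E]

namespace Place

/-- At an archimedean place `v.integers` is the whole completion. -/
instance (v : Place E) : IsLocalRing v.integers := by
  refine .of_isUnit_or_isUnit_one_sub_self fun x => ?_
  have hunit : ∀ y : v.integers, y.1 ≠ 0 → (v.IsNonarch → ‖y.1‖ = 1) → IsUnit y := by
    intro y hy hy1
    refine IsUnit.of_mul_eq_one ⟨y.1⁻¹, fun hv => ?_⟩ (Subtype.ext (mul_inv_cancel₀ hy))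
    rw [norm_inv, hy1 hv, inv_one]
  by_cases hv : v.IsNonarch
  · rcases (x.2 hv).lt_or_eq with hlt | heq
    · right
      have h1 : ‖1 - x.1‖ = 1 := by
        refine le_antisymm ((1 - x).2 hv) ?_
        by_contra! hcon
        have h2 := norm_add_le_max hv (1 - x.1) x.1
        rw [sub_add_cancel, norm_one] at h2
        exact absurd (h2.trans_lt (max_lt hcon hlt)) (lt_irrefl _)
      exact hunit (1 - x) (norm_ne_zero_iff.mp (by
        change ‖1 - x.1‖ ≠ 0; rw [h1]; exact one_ne_zero)) fun _ => h1
    · left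
      exact hunit x (norm_ne_zero_iff.mp (by rw [heq]; exact one_ne_zero)) fun _ => heq
  · by_cases hx : x = 0
    · right; rw [hx, sub_zero]; exact isUnit_one
    · left; exact hunit x (fun h => hx (Subtype.ext h)) fun h => absurd h hv

variable {σ : E ≃+* E}

lemma completionMap_eq_of_eq {u w : Place E} {v : Place E} (e : u = w)
    (h : ∀ x y, u.abs x ≤ u.abs y ↔ v.abs (σ x) ≤ v.abs (σ y))
    (h' : ∀ x y, w.abs x ≤ w.abs y ↔ v.abs (σ x) ≤ v.abs (σ y)) (x : ∀ v : Place E, v.Completion) :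
    completionMap h (x u) = completionMap h' (x w) := by
  subst e; rfl

variable (σ) in
/-- The coefficient ring at a place `w` of `E` of the adele ring of `E` with the involution induced
by `σ`: the graph of `σ` on `E_w` if `w ∘ σ = w`, and `E_w × E_w` otherwise. An adele `x` has the
component `(x_w, (x^*)_w)` in this ring, so that the involution is the exchange of coordinates. -/
def pairRing (w : Place E) : Subring (w.Completion × w.Completion) where
  carrier := {z | ∀ h : ∀ x y, w.abs x ≤ w.abs y ↔ w.abs (σ x) ≤ w.abs (σ y),
    z.2 = completionMap h z.1}
  zero_mem' h := (map_zero _).symm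
  one_mem' h := (map_one _).symm
  add_mem' hx hy h := by
    rw [Prod.fst_add, Prod.snd_add, map_add, hx h, hy h]
  mul_mem' hx hy h := by
    rw [Prod.fst_mul, Prod.snd_mul, map_mul, hx h, hy h]
  neg_mem' hx h := by
    rw [Prod.fst_neg, Prod.snd_neg, map_neg, hx h]

/-- The exchange involution of `pairRing σ w`. -/
@[reducible]
noncomputable def pairStarRing (hσ : ∀ x, σ (σ x) = x) (w : Place E) : StarRing (pairRing σ w) where
  star z := ⟨(z.1.2, z.1.1), fun h => by
    change z.1.1 = completionMap h z.1.2
    rw [z.2 h]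
    classical
    simpa using (completionMap_completionMap hσ rfl h h (Function.update 0 w z.1.1)).symm⟩
  star_involutive _ := rfl
  star_mul x y := Subtype.ext (Prod.ext (mul_comm _ _) (mul_comm _ _))
  star_add _ _ := rfl

/-- The elements of `pairRing σ w` with coordinates in `S`. -/
noncomputable def pairSubring (w : Place E) (S : Subring w.Completion) : Subring (pairRing σ w) :=
  (S.prod S).comap (pairRing σ w).subtype

/-- The residue field of the first coordinate serves as the residue division ring: an element whose
coordinates are both units of `S` is a unit. -/
lemma isStarStableOn_pairSubring (hσ : ∀ x, σ (σ x) = x) (w : Place E) (S : Subring w.Completion)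
    [IsLocalRing S] (hS : ∀ (h : ∀ x y, w.abs x ≤ w.abs y ↔ w.abs (σ x) ≤ w.abs (σ y)) (x),
      x ∈ S → completionMap h x ∈ S) (n : ℕ) :
    letI := pairStarRing hσ w
    IsStarStableOn (pairSubring (σ := σ) w S) n := by
  let := pairStarRing hσ w
  have hmem : ∀ z ∈ pairSubring (σ := σ) w S, star z ∈ pairSubring (σ := σ) w S :=
    fun z hz => ⟨hz.2, hz.1⟩
  let : StarRing (pairSubring (σ := σ) w S) :=
    { star := fun z => ⟨star z.1, hmem _ z.2⟩
      star_involutive := fun _ => rfl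
      star_mul := fun x y => Subtype.ext (star_mul x.1 y.1)
      star_add := fun _ _ => rfl }
  let g : pairSubring (σ := σ) w S →+* S :=
    { toFun := fun z => ⟨z.1.1.1, z.2.1⟩
      map_zero' := rfl
      map_one' := rfl
      map_add' := fun _ _ => rfl
      map_mul' := fun _ _ => rfl }
  have hg : Function.Surjective g := by
    intro y
    by_cases h : ∀ x y, w.abs x ≤ w.abs y ↔ w.abs (σ x) ≤ w.abs (σ y)
    · exact ⟨⟨⟨(y.1, completionMap h y.1), fun _ => rfl⟩, y.2, hS h _ y.2⟩, rfl⟩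
    · exact ⟨⟨⟨(y.1, 0), fun h' => absurd h' h⟩, y.2, S.zero_mem⟩, rfl⟩
  refine IsStarStable.isStarStableOn (pairSubring (σ := σ) w S).subtype (fun _ => rfl)
    Subtype.val_injective (isStarStable_matrix ((IsLocalRing.residue S).comp g)
    (IsLocalRing.residue_surjective.comp hg) (fun x h1 h2 => ?_) n) (Subring.range_subtype _)
  rw [RingHom.comp_apply, IsLocalRing.residue_ne_zero_iff_isUnit] at h1 h2
  obtain ⟨u1, hu1⟩ := h1.exists_right_inv
  obtain ⟨u2, hu2⟩ := h2.exists_right_inv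
  refine IsUnit.of_mul_eq_one ⟨⟨(u1.1, u2.1), fun h => ?_⟩, u1.2, u2.2⟩ ?_
  · have e1 : x.1.1.1 * u1.1 = 1 := congrArg Subtype.val hu1
    have e2 : x.1.1.2 * u2.1 = 1 := congrArg Subtype.val hu2
    rw [x.1.2 h] at e2
    change u2.1 = completionMap h u1.1
    refine (left_inv_eq_right_inv ?_ e2).symm
    rw [mul_comm, ← map_mul, e1, map_one]
  · exact Subtype.ext (Subtype.ext (Prod.ext (congrArg Subtype.val hu1) (congrArg Subtype.val hu2)))

end Place

/-- An involution has a set of representatives of its orbits. -/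
lemma exists_orbit_representatives {X : Type*} (s : X → X) (hs : ∀ x, s (s x) = x) :
    ∃ P : Set X, (∀ x, x ∉ P → s x ∈ P) ∧ ∀ x ∈ P, s x ∈ P → s x = x := by
  let : LinearOrder X := IsWellOrder.linearOrder WellOrderingRel
  refine ⟨{x | x ≤ s x}, fun x hx => ?_, fun x hx hx' => le_antisymm ?_ hx⟩
  · rw [Set.mem_ofPred_eq, not_le] at hx
    rw [Set.mem_ofPred_eq, hs]
    exact hx.le
  · rwa [Set.mem_ofPred_eq, hs] at hx'

variable {σ : E ≃+* E}

/-- The adele ring with the involution of `σ` is the restricted product of the rings `pairRing σ w`,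
where `w` runs through representatives of the orbits of `σ` on the places. -/
theorem isStarStable_matrix_adeleRing (hσ : ∀ x, σ (σ x) = x) (n : ℕ) :
    letI := galoisStarRing σ hσ
    IsStarStable (Matrix (Fin n) (Fin n) (AdeleRing E)) := by
  let := galoisStarRing σ hσ
  have hstar : ∀ (x : AdeleRing E) (v : Place E),
      (star x) v = Place.completionMap (Place.comap_abs σ v) (x (Place.comap σ v)) :=
    fun _ _ => rfl
  obtain ⟨P, hP1, hP2⟩ := exists_orbit_representatives (Place.comap σ) (Place.comap_comap σ hσ)
  have hfix : ∀ w : Place E, (∀ x y, w.abs x ≤ w.abs y ↔ w.abs (σ x) ≤ w.abs (σ y)) →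
      Place.comap σ w = w := by
    intro w hw
    exact Place.ext_abs fun x y => by rw [Place.comap_abs, ← hw]
  let φ : ∀ v : P, AdeleRing E →+* Place.pairRing σ v.1 := fun v =>
    { toFun := fun x => ⟨(x v, (star x) v), fun h => by
        rw [hstar]; exact Place.completionMap_eq_of_eq (hfix _ h) _ _ x⟩
      map_zero' := by
        apply Subtype.ext; change ((0 : AdeleRing E) v.1, star (0 : AdeleRing E) v.1) = _
        rw [star_zero]; rfl
      map_one' := by
        apply Subtype.ext; change ((1 : AdeleRing E) v.1, star (1 : AdeleRing E) v.1) = _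
        rw [star_one]; rfl
      map_add' := fun x y => by
        apply Subtype.ext; change ((x + y) v.1, star (x + y) v.1) = _; rw [star_add]; rfl
      map_mul' := fun x y => by
        apply Subtype.ext; change ((x * y) v.1, star (x * y) v.1) = _; rw [star_mul']; rfl }
  let := fun v : P => Place.pairStarRing hσ v.1
  refine isStarStable_matrix_of_local (V := P)
    (fun v => Place.pairSubring v.1 (Place.integers v.1)) φ (fun v x => ?_) (fun x y h => ?_)
    (fun β hβ => ?_) (fun x => ?_) (fun v => ?_) ?_
  · apply Subtype.ext
    change ((star x) v.1, (star (star x)) v.1) = ((star x) v.1, x v.1)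
    rw [star_star]
  · ext v
    by_cases hv : v ∈ P
    · exact congrArg (fun z => z.1.1) (h ⟨v, hv⟩)
    · have h1 : star x (Place.comap σ v) = star y (Place.comap σ v) :=
        congrArg (fun z => z.1.2) (h ⟨_, hP1 v hv⟩)
      rw [← star_star x, ← star_star y, hstar, hstar (star y), h1]
  · -- The adele with components `z` is the one given by `β` at the representatives; at the other
    -- places its components are determined by those of its image under the involution.
    classical
    let β₁ : ∀ v : Place E, v.Completion := fun v => if h : v ∈ P then (β ⟨v, h⟩).1.1 else 0
    let β₂ : ∀ v : Place E, v.Completion := fun v => if h : v ∈ P then (β ⟨v, h⟩).1.2 else 0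
    let z : ∀ v : Place E, v.Completion := fun v => if v ∈ P then β₁ v else
      Place.completionMap (Place.comap_abs σ v) (β₂ (Place.comap σ v))
    have hβ₁₂ : ∀ᶠ v in Filter.cofinite, β₁ v ∈ v.integers ∧ β₂ v ∈ v.integers := by
      refine (Set.Finite.image Subtype.val hβ).subset fun v hv => ?_
      by_contra hcon
      refine hv ?_
      by_cases hvP : v ∈ P
      · have : β ⟨v, hvP⟩ ∈ Place.pairSubring v v.integers := by
          by_contra h'
          exact hcon ⟨⟨v, hvP⟩, h', rfl⟩
        exact ⟨by simp only [β₁, dif_pos hvP]; exact this.1,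
          by simp only [β₂, dif_pos hvP]; exact this.2⟩
      · exact ⟨by simp only [β₁, dif_neg hvP]; exact zero_mem _,
          by simp only [β₂, dif_neg hvP]; exact zero_mem _⟩
    have hz : ∀ᶠ v in Filter.cofinite, z v ∈ v.integers := by
      filter_upwards [hβ₁₂, (Place.comap_injective σ).tendsto_cofinite.eventually hβ₁₂] with v h1 h2
      by_cases hvP : v ∈ P
      · simpa only [z, if_pos hvP] using h1.1
      · simpa only [z, if_neg hvP] using Place.completionMap_mem _ h2.2
    refine ⟨⟨z, hz⟩, fun v => Subtype.ext (Prod.ext ?_ ?_)⟩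
    · change z v.1 = _
      simp only [z, β₁, if_pos v.2, dif_pos v.2]
    · change Place.completionMap (Place.comap_abs σ v.1) (z (Place.comap σ v.1)) = _
      by_cases hv : Place.comap σ v.1 ∈ P
      · have he := hP2 v.1 v.2 hv
        have h : ∀ x y, v.1.abs x ≤ v.1.abs y ↔ v.1.abs (σ x) ≤ v.1.abs (σ y) := fun x y => by
          conv_lhs => rw [← he]
          exact Place.comap_abs σ v.1 x y
        rw [Place.completionMap_eq_of_eq he _ h z, (β v).2 h]
        simp only [z, β₁, if_pos v.2, dif_pos v.2]
      · have h1 : z (Place.comap σ v.1) = Place.completionMap (Place.comap_abs σ _)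
            (β₂ (Place.comap σ (Place.comap σ v.1))) := by
          simp only [z, if_neg hv]
        rw [h1, Place.completionMap_completionMap hσ (Place.comap_comap σ hσ v.1)]
        simp only [β₂, dif_pos v.2]
  · have h1 := (Subtype.val_injective (p := (· ∈ P))).tendsto_cofinite.eventually (p := fun v : Place E =>
      x v ∈ v.integers ∧ (star x) v ∈ v.integers) (x.2.and (star x).2)
    exact h1.mono fun v hv => hv
  -- The full factors are the case `S = ⊤`, since a field is a local ring.
  · have : IsLocalRing (⊤ : Subring v.1.Completion) := Subring.topEquiv.symm.isLocalRing
    have h := Place.isStarStableOn_pairSubring hσ v.1 ⊤ (fun _ _ _ => trivial) n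
    rintro a c ⟨h1, x, y, h2⟩
    obtain ⟨b, u, -, -, hb, hu, hu'⟩ := h a c x y (fun _ _ => ⟨trivial, trivial⟩)
      (fun _ _ => ⟨trivial, trivial⟩) (fun _ _ => ⟨trivial, trivial⟩)
      (fun _ _ => ⟨trivial, trivial⟩) h1 h2
    exact ⟨b, hb, isUnit_iff_exists.mpr ⟨u, hu, hu'⟩⟩
  · exact Filter.Eventually.of_forall fun v => Place.isStarStableOn_pairSubring hσ v.1 _
      (fun h x hx => Place.completionMap_mem h hx) n

lemma adeleMap_refl (x : AdeleRing E) : adeleMap (RingEquiv.refl E) x = x := by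
  ext v
  have h : ∀ x y, v.abs x ≤ v.abs y ↔
      v.abs (RingEquiv.refl E x) ≤ v.abs (RingEquiv.refl E y) := fun _ _ => Iff.rfl
  have he : Place.comap (RingEquiv.refl E) v = v := Place.ext_abs fun x y => Place.comap_abs _ v x y
  have h1 : adeleMap (RingEquiv.refl E) x v =
    Place.completionMap (Place.comap_abs _ v) (x (Place.comap (RingEquiv.refl E) v)) := rfl
  rw [h1, Place.completionMap_eq_of_eq he _ h x]
  generalize x v = t
  induction t using UniformSpace.Completion.induction_on with
  | hp => exact isClosed_eq (Place.continuous_completionMap h) continuous_id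
  | ih a => rw [Place.completionMap_coe]; rfl

lemma starRing_ext {A : Type*} [NonUnitalNonAssocSemiring A] {s₁ s₂ : StarRing A}
    (h : ∀ x, s₁.star x = s₂.star x) : s₁ = s₂ := by
  rcases s₁ with @⟨@⟨@⟨⟨f⟩, _⟩, _⟩, _⟩
  rcases s₂ with @⟨@⟨@⟨⟨g⟩, _⟩, _⟩, _⟩
  obtain rfl : f = g := funext h
  rfl

/-- The trivial involution is the one induced by the identity of the field. -/
theorem isStarStable_matrix_adeleRing_comm (n : ℕ) :
    letI : StarRing (AdeleRing E) := starRingOfComm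
    IsStarStable (Matrix (Fin n) (Fin n) (AdeleRing E)) := by
  have hσ : ∀ x : E, RingEquiv.refl E (RingEquiv.refl E x) = x := fun _ => rfl
  have h : (starRingOfComm : StarRing (AdeleRing E)) = galoisStarRing (RingEquiv.refl E) hσ :=
    starRing_ext fun x => (adeleMap_refl x).symm
  rw [h]
  exact isStarStable_matrix_adeleRing hσ n

end GaloisAdeles

/-! ### Quaternion algebras in characteristic two -/

section Twist

/-- Changing the involution by a symmetric element `w` with `w² = 1`: if `(a, c)` is a star pair
for the twisted involution then `(a, w c)` is one for the original involution. -/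
lemma IsStarStable.of_twist {A B : Type*} [Ring A] [StarRing A] [Ring B] [StarRing B] (e : A ≃+* B)
    (w : B) (hw : w * w = 1) (hw' : star w = w) (he : ∀ x, e (star x) = w * star (e x) * w)
    (h : IsStarStable B) : IsStarStable A := by
  rintro a c ⟨hac, x, y, hxy⟩
  have h1 : ∀ p q : A, star (e p) * (w * e q) = w * e (star p * q) := fun p q => by
    rw [map_mul, he]; simp only [← mul_assoc, hw, one_mul]
  obtain ⟨b, hb, hu⟩ := h (e a) (w * e c) ⟨by
      rw [h1, hac, ← h1, star_mul, hw', mul_assoc], e x, e y * w, by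
      rw [mul_assoc, ← mul_assoc w, hw, one_mul, ← map_mul, ← map_mul, ← map_add, hxy, map_one]⟩
  refine ⟨e.symm (b * w), e.injective ?_, ?_⟩
  · rw [he, e.apply_symm_apply, star_mul, hb, hw', ← mul_assoc, hw, one_mul]
  · rw [← MulEquiv.isUnit_map e]
    simpa [mul_assoc] using hu

/-- Lifting the stable range condition along a surjection for which units and symmetric elements
lift. -/
lemma IsStarStable.matrix_of_surjective {R T : Type*} [Ring R] [StarRing R] [Ring T] [StarRing T]
    (π : R →+* T) (hstar : ∀ x, π (star x) = star (π x)) (hsurj : Function.Surjective π)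
    (hunit : ∀ x, π x = 1 → IsUnit x) (hsym : ∀ y, star y = y → ∃ x, star x = x ∧ π x = y) {n : ℕ}
    (h : IsStarStable (Matrix (Fin n) (Fin n) T)) : IsStarStable (Matrix (Fin n) (Fin n) R) := by
  have hsurj' : ∀ Y : Matrix (Fin n) (Fin n) T, ∃ X, π.mapMatrix X = Y := fun Y => by
    choose X hX using fun i j => hsurj (Y i j)
    exact ⟨Matrix.of X, by ext i j; exact hX i j⟩
  intro a c hac
  obtain ⟨b, hb, u, hu⟩ := h _ _ (hac.map π.mapMatrix (star_mapMatrix π hstar))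
  have hbij : ∀ i j, star (b j i) = b i j := fun i j => congrFun (congrFun hb i) j
  choose d hd hd' using fun i => hsym (b i i) (hbij i i)
  obtain ⟨b₀, hb₀⟩ := hsurj' b
  have hb₀ : ∀ i j, π (b₀ i j) = b i j := fun i j => congrFun (congrFun hb₀ i) j
  -- Only the diagonal of `b` needs symmetric lifts; below it, the lifts above it are reflected.
  let b' : Matrix (Fin n) (Fin n) R := Matrix.of fun i j =>
    if i < j then b₀ i j else if j < i then star (b₀ j i) else d i
  have hb' : π.mapMatrix b' = b := by
    ext i j
    change π (if i < j then b₀ i j else if j < i then star (b₀ j i) else d i) = b i j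
    split_ifs with h1 h2
    · exact hb₀ i j
    · rw [hstar, hb₀, hbij]
    · rw [hd', le_antisymm (not_lt.mp h2) (not_lt.mp h1)]
  obtain ⟨z, hz⟩ := hsurj' (u⁻¹).1
  have h1 : IsUnit ((a + b' * c) * z) := isUnit_of_map_eq_one π hunit n _ (by
    rw [map_mul, map_add, map_mul, hb', ← hu, hz, Units.mul_inv])
  have h2 : IsUnit (z * (a + b' * c)) := isUnit_of_map_eq_one π hunit n _ (by
    rw [map_mul, map_add, map_mul, hb', ← hu, hz, Units.inv_mul])
  refine ⟨b', ?_, ?_⟩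
  · ext i j
    change star (if j < i then b₀ j i else if i < j then star (b₀ i j) else d j) =
      if i < j then b₀ i j else if j < i then star (b₀ j i) else d i
    split_ifs with h1 h2 h3 <;> first | rfl | exact star_star _ | skip
    · exact absurd h1 (not_lt.mpr h2.le)
    · rw [hd, le_antisymm (not_lt.mp h1) (not_lt.mp h3)]
  · obtain ⟨p, hp⟩ := h1
    obtain ⟨q, hq⟩ := h2
    exact isUnit_iff_exists_and_exists.mpr
      ⟨⟨z * (p⁻¹).1, by rw [← mul_assoc, ← hp, Units.mul_inv]⟩,
        (q⁻¹).1 * z, by rw [mul_assoc, ← hq, Units.inv_mul]⟩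

end Twist

section QuaternionLocal

/-- The reduced norm of a quaternion. -/
def quaternionNorm {R : Type*} [CommRing R] {a b c : R} (x : ℍ[R,a,b,c]) : R :=
  (x.re ^ 2 + b * x.re * x.imI - a * x.imI ^ 2) -
    c * (x.imJ ^ 2 + b * x.imJ * x.imK - a * x.imK ^ 2)

lemma quaternionNorm_mul_star {R : Type*} [CommRing R] {a b c : R} (x : ℍ[R,a,b,c]) :
    x * star x = ((quaternionNorm x : R) : ℍ[R,a,b,c]) := by
  ext <;> simp <;> (try rw [quaternionNorm]) <;> ring

lemma quaternionNorm_star_mul {R : Type*} [CommRing R] {a b c : R} (x : ℍ[R,a,b,c]) :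
    star x * x = ((quaternionNorm x : R) : ℍ[R,a,b,c]) := by
  ext <;> simp <;> (try rw [quaternionNorm]) <;> ring

lemma isUnit_of_isUnit_quaternionNorm {R : Type*} [CommRing R] {a b c : R} {x : ℍ[R,a,b,c]}
    (h : IsUnit (quaternionNorm x)) : IsUnit x := by
  obtain ⟨r, hr⟩ := h.exists_right_inv
  refine isUnit_iff_exists_and_exists.mpr ⟨⟨star x * (r : ℍ[R,a,b,c]), ?_⟩,
    (r : ℍ[R,a,b,c]) * star x, ?_⟩
  · rw [← mul_assoc, quaternionNorm_mul_star, ← QuaternionAlgebra.coe_mul, hr,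
      QuaternionAlgebra.coe_one]
  · rw [mul_assoc, quaternionNorm_star_mul, ← QuaternionAlgebra.coe_mul, mul_comm, hr,
      QuaternionAlgebra.coe_one]

variable {K : Type*} [Field K] {a b c : K}

/-- If the quaternion algebra is not a division algebra, `c` is a norm from `K[i]`. -/
lemma exists_norm_eq (h2 : (2 : K) = 0) (hb : b ≠ 0) {x : ℍ[K,a,b,c]} (hx : x ≠ 0)
    (h0 : quaternionNorm x = 0) : ∃ y z : K, y ^ 2 + b * y * z - a * z ^ 2 = c := by
  by_cases hr : ∃ r : K, r ^ 2 = b * r + a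
  · -- `K[i]` is `K × K`, where the norm is the product of the coordinates.
    obtain ⟨r, hr⟩ := hr
    refine ⟨c - (1 - c) / b * r, (1 - c) / b, ?_⟩
    field_simp
    linear_combination (1 - c) ^ 2 * hr - c * r * (1 - c) * b * h2
  · push Not at hr
    have haniso : ∀ y z : K, y ^ 2 + b * y * z - a * z ^ 2 = 0 → z = 0 := by
      intro y z hyz
      by_contra hz
      apply hr (-y / z)
      field_simp
      linear_combination hyz
    have hJK : x.imJ ^ 2 + b * x.imJ * x.imK - a * x.imK ^ 2 ≠ 0 := by
      intro h
      have hK := haniso _ _ h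
      rw [quaternionNorm, h, mul_zero, sub_zero] at h0
      have hI := haniso _ _ h0
      apply hx
      ext
      · simpa [hI] using h0
      · exact hI
      · simpa [hK] using h
      · exact hK
    rw [quaternionNorm] at h0
    obtain ⟨N, hN⟩ : ∃ N, N = x.imJ ^ 2 + b * x.imJ * x.imK - a * x.imK ^ 2 := ⟨_, rfl⟩
    rw [← hN] at hJK h0
    -- The coordinates of the quotient of `x.re + x.imI i` by `x.imJ + x.imK i` in `K[i]`.
    refine ⟨(x.re * x.imJ + b * x.re * x.imK - a * x.imI * x.imK) / N,
      (x.imI * x.imJ - x.re * x.imK) / N, ?_⟩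
    field_simp
    linear_combination N * h0 - (x.re ^ 2 + b * x.re * x.imI - a * x.imI ^ 2) * hN

/-- If `c` is the norm of `y + z i`, the quaternion algebra acts on `K[i]`: the element `i` acts by
multiplication, and `j` by conjugation followed by the multiplication with `y + z i`. -/
def splitBasis {y z : K} (hc : y ^ 2 + b * y * z - a * z ^ 2 = c) :
    QuaternionAlgebra.Basis (Matrix (Fin 2) (Fin 2) K) a b c where
  i := !![0, a; 1, b]
  j := !![y, b * y - a * z; z, -y]
  k := !![a * z, -(a * y); y + b * z, -(a * z)]
  i_mul_i := by
    ext i j; fin_cases i <;> fin_cases j <;>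
      simp [Matrix.mul_apply, Fin.sum_univ_two, mul_comm]
  j_mul_j := by
    subst hc
    ext i j; fin_cases i <;> fin_cases j <;> simp [Matrix.mul_apply, Fin.sum_univ_two] <;> ring
  i_mul_j := by
    ext i j; fin_cases i <;> fin_cases j <;> simp [Matrix.mul_apply, Fin.sum_univ_two] <;> ring
  j_mul_i := by
    ext i j; fin_cases i <;> fin_cases j <;> simp [Matrix.mul_apply, Fin.sum_univ_two] <;> ring

lemma splitBasis_liftHom {y z : K} (hc : y ^ 2 + b * y * z - a * z ^ 2 = c) (x : ℍ[K,a,b,c]) :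
    (splitBasis hc).liftHom x =
      !![x.re + x.imJ * y + x.imK * (a * z), x.imI * a + x.imJ * (b * y - a * z) - x.imK * (a * y);
        x.imI + x.imJ * z + x.imK * (y + b * z),
          x.re + x.imI * b - x.imJ * y - x.imK * (a * z)] := by
  change (splitBasis hc).lift x = _
  ext i j; fin_cases i <;> fin_cases j <;>
    simp [QuaternionAlgebra.Basis.lift, splitBasis, Matrix.algebraMap_matrix_apply] <;> ring

lemma bijective_splitBasis_liftHom (h2 : (2 : K) = 0) (hb : b ≠ 0) (hc0 : c ≠ 0) {y z : K}
    (hc : y ^ 2 + b * y * z - a * z ^ 2 = c) : Function.Bijective (splitBasis hc).liftHom := by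
  have hinj : Function.Injective (splitBasis hc).liftHom.toLinearMap := by
    rw [← LinearMap.ker_eq_bot, LinearMap.ker_eq_bot']
    intro x hx
    rw [AlgHom.toLinearMap_apply, splitBasis_liftHom] at hx
    have h00 := congrFun (congrFun hx 0) 0
    have h01 := congrFun (congrFun hx 0) 1
    have h10 := congrFun (congrFun hx 1) 0
    have h11 := congrFun (congrFun hx 1) 1
    simp at h00 h01 h10 h11
    have hI : x.imI = 0 := by
      have : b * x.imI = 0 := by linear_combination h00 + h11 - x.re * h2
      exact (mul_eq_zero.mp this).resolve_left hb
    rw [hI] at h01 h10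
    have hJ : x.imJ = 0 := by
      have : b * c * x.imJ = 0 := by
        linear_combination (y + b * z) * h01 + a * y * h10 - b * x.imJ * hc
      exact (mul_eq_zero.mp this).resolve_left (mul_ne_zero hb hc0)
    have hK : x.imK = 0 := by
      have : b * c * x.imK = 0 := by
        linear_combination (b * y - a * z) * h10 - z * h01 - b * x.imK * hc
      exact (mul_eq_zero.mp this).resolve_left (mul_ne_zero hb hc0)
    rw [hJ, hK] at h00
    ext
    · simpa using h00
    · exact hI
    · exact hJ
    · exact hK
  refine ⟨hinj, ?_⟩
  have := (LinearMap.injective_iff_surjective_of_finrank_eq_finrank (by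
    rw [QuaternionAlgebra.finrank_eq_four, Module.finrank_matrix]; simp)).mp hinj
  exact this

/-- The exchange of the two coordinates in every pair of a family of coordinates. -/
def pairSwap (n : ℕ) : Equiv.Perm (Fin n × Fin 2) := Equiv.prodCongr (Equiv.refl _) (Equiv.swap 0 1)

lemma isStarStable_matrix_of_field (K : Type*) [Field K] (m : ℕ) :
    letI : StarRing K := starRingOfComm
    IsStarStable (Matrix (Fin m) (Fin m) K) :=
  letI : StarRing K := starRingOfComm
  isStarStable_matrix (RingHom.id K) Function.surjective_id (fun _ h _ => IsUnit.mk0 _ h) m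

/-- A split quaternion algebra in characteristic two: up to the exchange of coordinates, quaternion
conjugation is the transposition of matrices. -/
lemma isStarStable_matrix_of_split (h2 : (2 : K) = 0) (hb : b ≠ 0) (hc0 : c ≠ 0) {y z : K}
    (hc : y ^ 2 + b * y * z - a * z ^ 2 = c) (n : ℕ) :
    IsStarStable (Matrix (Fin n) (Fin n) ℍ[K,a,b,c]) := by
  let : StarRing K := starRingOfComm
  have h2' : ∀ x : K, -x = x := fun x => by linear_combination -x * h2
  let e₀ : ℍ[K,a,b,c] ≃ₐ[K] Matrix (Fin 2) (Fin 2) K :=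
    AlgEquiv.ofBijective _ (bijective_splitBasis_liftHom h2 hb hc0 hc)
  have he₀ : ∀ x p q, e₀ (star x) p q = e₀ x (Equiv.swap 0 1 q) (Equiv.swap 0 1 p) := by
    intro x p q
    change (splitBasis hc).liftHom (star x) p q = (splitBasis hc).liftHom x _ _
    rw [splitBasis_liftHom, splitBasis_liftHom]
    fin_cases p <;> fin_cases q
    · simp; ring
    · simp; rw [← h2' (_ + _ - _)]; ring
    · simp; rw [← h2' (_ + _ + _)]; ring
    · simp; ring
  let e : Matrix (Fin n) (Fin n) ℍ[K,a,b,c] ≃+* Matrix (Fin n × Fin 2) (Fin n × Fin 2) K :=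
    (e₀ : ℍ[K,a,b,c] ≃+* _).mapMatrix.trans (Matrix.compRingEquiv (Fin n) (Fin 2) K)
  have he : ∀ X i p j q, e X (i, p) (j, q) = e₀ (X i j) p q := fun _ _ _ _ _ => rfl
  have hs : (pairSwap n)⁻¹ = pairSwap n := rfl
  refine IsStarStable.of_twist e ((pairSwap n).permMatrix K) ?_ ?_ (fun X => ?_)
    ((isStarStable_matrix_of_field K (n * 2)).reindex finProdFinEquiv.symm)
  · rw [← Matrix.permMatrix_mul]
    nth_rewrite 1 [← hs]
    simp
  · rw [Matrix.star_eq_conjTranspose]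
    ext i j
    rw [Matrix.conjTranspose_apply]
    change ((pairSwap n).permMatrix K) j i = _
    simp only [Equiv.Perm.permMatrix, PEquiv.toMatrix_apply, Equiv.toPEquiv_apply, Option.mem_some_iff]
    have : pairSwap n j = i ↔ pairSwap n i = j := by
      rw [← hs, Equiv.Perm.inv_eq_iff_eq, hs, eq_comm]
    simp only [this]
  · ext ⟨i, p⟩ ⟨j, q⟩
    rw [he]
    change e₀ (star (X j i)) p q = _
    rw [he₀]
    simp [Equiv.Perm.permMatrix, PEquiv.toMatrix_toPEquiv_mul, PEquiv.mul_toMatrix_toPEquiv]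
    rfl

/-- Matrices over a quaternion algebra over a field of characteristic two. -/
theorem isStarStable_matrix_quaternion_field (h2 : (2 : K) = 0) (hb : b ≠ 0) (hc0 : c ≠ 0) (n : ℕ) :
    IsStarStable (Matrix (Fin n) (Fin n) ℍ[K,a,b,c]) := by
  by_cases h : ∃ x : ℍ[K,a,b,c], x ≠ 0 ∧ quaternionNorm x = 0
  · obtain ⟨x, hx, h0⟩ := h
    obtain ⟨y, z, hyz⟩ := exists_norm_eq h2 hb hx h0
    exact isStarStable_matrix_of_split h2 hb hc0 hyz n
  · push Not at h
    have hu : ∀ x : ℍ[K,a,b,c], x ≠ 0 → IsUnit x := fun x hx =>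
      isUnit_of_isUnit_quaternionNorm (IsUnit.mk0 _ (h x hx))
    let : DivisionRing ℍ[K,a,b,c] := DivisionRing.ofIsUnitOrEqZero fun x =>
      or_iff_not_imp_right.mpr (hu x)
    exact isStarStable_matrix (RingHom.id ℍ[K,a,b,c]) Function.surjective_id (fun x hx _ => hu x hx) n

/-- The homomorphism of quaternion algebras given by a homomorphism of the coefficient rings. -/
def quaternionMap {R S : Type*} [CommRing R] [CommRing S] (φ : R →+* S) {a b c : R} {a' b' c' : S}
    (ha : φ a = a') (hb : φ b = b') (hc : φ c = c') : ℍ[R,a,b,c] →+* ℍ[S,a',b',c'] where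
  toFun x := ⟨φ x.re, φ x.imI, φ x.imJ, φ x.imK⟩
  map_zero' := by ext <;> simp
  map_one' := by ext <;> simp
  map_add' x y := by ext <;> simp
  map_mul' x y := by subst ha hb hc; ext <;> simp

lemma quaternionMap_star {R S : Type*} [CommRing R] [CommRing S] (φ : R →+* S) {a b c : R}
    {a' b' c' : S} (ha : φ a = a') (hb : φ b = b') (hc : φ c = c') (x : ℍ[R,a,b,c]) :
    quaternionMap φ ha hb hc (star x) = star (quaternionMap φ ha hb hc x) := by
  subst ha hb hc
  ext <;> simp [quaternionMap]

/-- Matrices over an order in a quaternion algebra in characteristic two, over a local ring. The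
symmetric quaternions are those without `i`-component, so that they lift from the residue field. -/
theorem isStarStable_matrix_quaternion_local {R : Type*} [CommRing R] [IsLocalRing R] {a b c : R}
    (h2 : (2 : R) = 0) (hb : IsUnit b) (hc : IsUnit c) (n : ℕ) :
    IsStarStable (Matrix (Fin n) (Fin n) ℍ[R,a,b,c]) := by
  let φ := IsLocalRing.residue R
  have hb' : φ b ≠ 0 := (IsLocalRing.residue_ne_zero_iff_isUnit b).mpr hb
  have hc' : φ c ≠ 0 := (IsLocalRing.residue_ne_zero_iff_isUnit c).mpr hc
  have h2' : (2 : IsLocalRing.ResidueField R) = 0 := by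
    rw [← map_ofNat φ 2, h2, map_zero]
  have hφ : Function.Surjective φ := IsLocalRing.residue_surjective
  refine IsStarStable.matrix_of_surjective (quaternionMap φ rfl rfl rfl)
    (quaternionMap_star φ rfl rfl rfl) (fun y => ?_) (fun x hx => ?_) (fun y hy => ?_)
    (isStarStable_matrix_quaternion_field h2' hb' hc' n)
  · obtain ⟨y₀, h₀⟩ := hφ y.re
    obtain ⟨y₁, h₁⟩ := hφ y.imI
    obtain ⟨y₂, h₂⟩ := hφ y.imJ
    obtain ⟨y₃, h₃⟩ := hφ y.imK
    exact ⟨⟨y₀, y₁, y₂, y₃⟩, QuaternionAlgebra.ext h₀ h₁ h₂ h₃⟩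
  · apply isUnit_of_isUnit_quaternionNorm
    rw [← IsLocalRing.residue_ne_zero_iff_isUnit]
    have h₀ : φ x.re = 1 := congrArg QuaternionAlgebra.re hx
    have h₁ : φ x.imI = 0 := congrArg QuaternionAlgebra.imI hx
    have h₂ : φ x.imJ = 0 := congrArg QuaternionAlgebra.imJ hx
    have h₃ : φ x.imK = 0 := congrArg QuaternionAlgebra.imK hx
    have : φ (quaternionNorm x) = 1 := by
      simp [quaternionNorm, h₀, h₁, h₂, h₃]
    exact this.trans_ne one_ne_zero
  · have h₁ : y.imI = 0 := by
      have := congrArg QuaternionAlgebra.re hy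
      rw [QuaternionAlgebra.re_star, add_eq_left] at this
      exact (mul_eq_zero.mp this).resolve_left hb'
    obtain ⟨y₀, h₀⟩ := hφ y.re
    obtain ⟨y₂, h₂⟩ := hφ y.imJ
    obtain ⟨y₃, h₃⟩ := hφ y.imK
    have hneg : ∀ x : R, -x = x := fun x => by linear_combination -x * h2
    refine ⟨⟨y₀, 0, y₂, y₃⟩, ?_, QuaternionAlgebra.ext h₀ (h₁ ▸ map_zero φ) h₂ h₃⟩
    ext <;> simp [hneg]

end QuaternionLocal

/-! ### Adelic quaternions -/

section AdelicQuaternion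

variable {F : Type*} [Field F] [IsGlobalField F]

/-- The subring of quaternions with coordinates in a subring of the coefficient ring. -/
def quaternionSubring {K : Type*} [CommRing K] (S : Subring K) {a b c : K} (ha : a ∈ S) (hb : b ∈ S)
    (hc : c ∈ S) : Subring ℍ[K,a,b,c] :=
  (quaternionMap S.subtype (a := ⟨a, ha⟩) (b := ⟨b, hb⟩) (c := ⟨c, hc⟩) rfl rfl rfl).range

/-- The quaternions over the adele ring are the restricted product of the quaternions over the
completions. The distinguished subring consists of the quaternions over the ring of integers where
the structure constants are integral; at the finitely many other places it does not matter. -/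
theorem isStarStable_matrix_quaternion_adeleRing [CharP F 2] (a : F) {b c : F} (hb : b ≠ 0)
    (hc : c ≠ 0) (n : ℕ) :
    IsStarStable (Matrix (Fin n) (Fin n) ℍ[AdeleRing F, algebraMap F (AdeleRing F) a,
      algebraMap F (AdeleRing F) b, algebraMap F (AdeleRing F) c]) := by
  classical
  generalize hα : algebraMap F (AdeleRing F) a = α
  generalize hβ : algebraMap F (AdeleRing F) b = β
  generalize hγ : algebraMap F (AdeleRing F) c = γ
  obtain ⟨β', hβ'⟩ : ∃ β' : AdeleRing F, β * β' = 1 :=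
    ⟨algebraMap F (AdeleRing F) b⁻¹, by rw [← hβ, ← map_mul, mul_inv_cancel₀ hb, map_one]⟩
  obtain ⟨γ', hγ'⟩ : ∃ γ' : AdeleRing F, γ * γ' = 1 :=
    ⟨algebraMap F (AdeleRing F) c⁻¹, by rw [← hγ, ← map_mul, mul_inv_cancel₀ hc, map_one]⟩
  have hβv : ∀ v, β v * β' v = 1 := fun v => congrArg (fun x : AdeleRing F => x v) hβ'
  have hγv : ∀ v, γ v * γ' v = 1 := fun v => congrArg (fun x : AdeleRing F => x v) hγ'
  have h2 : (2 : AdeleRing F) = 0 := by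
    rw [← map_ofNat (algebraMap F (AdeleRing F)) 2, CharTwo.two_eq_zero, map_zero]
  have h2v : ∀ v : Place F, (2 : v.Completion) = 0 := fun v =>
    congrArg (fun x : AdeleRing F => x v) h2
  -- From here on the structure constants are arbitrary adeles.
  clear hα hβ hγ h2 hβ' hγ'
  let S : ∀ v : Place F, Subring ℍ[v.Completion, α v, β v, γ v] := fun v =>
    if h : α v ∈ v.integers ∧ β v ∈ v.integers ∧ γ v ∈ v.integers then
      quaternionSubring v.integers h.1 h.2.1 h.2.2 else ⊤
  have hmemS : ∀ v (x : ℍ[v.Completion, α v, β v, γ v]), x.re ∈ v.integers →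
      x.imI ∈ v.integers → x.imJ ∈ v.integers → x.imK ∈ v.integers → x ∈ S v := by
    intro v x h₀ h₁ h₂ h₃
    by_cases h : α v ∈ v.integers ∧ β v ∈ v.integers ∧ γ v ∈ v.integers
    · simp only [S, dif_pos h]
      exact ⟨⟨⟨_, h₀⟩, ⟨_, h₁⟩, ⟨_, h₂⟩, ⟨_, h₃⟩⟩, rfl⟩
    · simp only [S, dif_neg h]
      trivial
  refine isStarStable_matrix_of_local (V := Place F) S
    (fun v => quaternionMap (RestrictedProduct.evalRingHom _ v) rfl rfl rfl)
    (fun v => quaternionMap_star _ rfl rfl rfl) (fun x y h => ?_) (fun q hq => ?_) (fun x => ?_)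
    (fun v => ?_) ?_
  · ext v
    · exact congrArg QuaternionAlgebra.re (h v)
    · exact congrArg QuaternionAlgebra.imI (h v)
    · exact congrArg QuaternionAlgebra.imJ (h v)
    · exact congrArg QuaternionAlgebra.imK (h v)
  · have hint : ∀ᶠ v in Filter.cofinite, (q v).re ∈ v.integers ∧ (q v).imI ∈ v.integers ∧
        (q v).imJ ∈ v.integers ∧ (q v).imK ∈ v.integers := by
      filter_upwards [α.2, β.2, γ.2, hq] with v h₁ h₂ h₃ h₄
      simp only [S, dif_pos (show α v ∈ v.integers ∧ β v ∈ v.integers ∧ γ v ∈ v.integers from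
        ⟨h₁, h₂, h₃⟩)] at h₄
      obtain ⟨x, hx⟩ := h₄
      rw [← hx]
      exact ⟨x.re.2, x.imI.2, x.imJ.2, x.imK.2⟩
    exact ⟨⟨⟨fun v => (q v).re, hint.mono fun v h => h.1⟩,
      ⟨fun v => (q v).imI, hint.mono fun v h => h.2.1⟩,
      ⟨fun v => (q v).imJ, hint.mono fun v h => h.2.2.1⟩,
      ⟨fun v => (q v).imK, hint.mono fun v h => h.2.2.2⟩⟩, fun v => rfl⟩
  · filter_upwards [x.re.2, x.imI.2, x.imJ.2, x.imK.2] with v h₀ h₁ h₂ h₃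
    exact hmemS v _ h₀ h₁ h₂ h₃
  · exact isStarStable_matrix_quaternion_field (h2v v) (left_ne_zero_of_mul_eq_one (hβv v))
      (left_ne_zero_of_mul_eq_one (hγv v)) n
  · filter_upwards [α.2, β.2, γ.2, β'.2, γ'.2] with v h₁ h₂ h₃ h₄ h₅
    simp only [S, dif_pos (show α v ∈ v.integers ∧ β v ∈ v.integers ∧ γ v ∈ v.integers from
      ⟨h₁, h₂, h₃⟩)]
    have hβu : IsUnit (⟨β v, h₂⟩ : v.integers) :=
      IsUnit.of_mul_eq_one ⟨β' v, h₄⟩ (Subtype.ext (hβv v))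
    have hγu : IsUnit (⟨γ v, h₃⟩ : v.integers) :=
      IsUnit.of_mul_eq_one ⟨γ' v, h₅⟩ (Subtype.ext (hγv v))
    have h2u : (2 : v.integers) = 0 := Subtype.ext (h2v v)
    refine IsStarStable.isStarStableOn (quaternionMap v.integers.subtype (a := ⟨α v, h₁⟩)
      (b := ⟨β v, h₂⟩) (c := ⟨γ v, h₃⟩) rfl rfl rfl)
      (quaternionMap_star v.integers.subtype rfl rfl rfl) (fun x y hxy => ?_)
      (isStarStable_matrix_quaternion_local (a := ⟨α v, h₁⟩) h2u hβu hγu n) rfl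
    exact QuaternionAlgebra.ext (Subtype.ext (congrArg QuaternionAlgebra.re hxy))
      (Subtype.ext (congrArg QuaternionAlgebra.imI hxy))
      (Subtype.ext (congrArg QuaternionAlgebra.imJ hxy))
      (Subtype.ext (congrArg QuaternionAlgebra.imK hxy))

end AdelicQuaternion

section ExtendScalars

variable {F : Type*} [Field F] {A : Type*} [CommRing A] [Algebra F A]

/-- Extension of scalars of a quaternion algebra. -/
lemma exists_tensorProduct_ringEquiv (a b c : F) {H : Type*} [Ring H] [Algebra F H]
    [StarRing H] (e : H ≃⋆ₐ[F] ℍ[F,a,b,c]) :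
    ∃ g : H ⊗[F] A ≃+* ℍ[A, algebraMap F A a, algebraMap F A b, algebraMap F A c],
      ∀ h y, g (h ⊗ₜ y) = quaternionMap (algebraMap F A) rfl rfl rfl (e h) *
        (y : ℍ[A, algebraMap F A a, algebraMap F A b, algebraMap F A c]) := by
  let f₁ : H →ₐ[F] ℍ[A, algebraMap F A a, algebraMap F A b, algebraMap F A c] :=
    { (quaternionMap (algebraMap F A) rfl rfl rfl).comp
        (RingHomClass.toRingHom e) with
      commutes' := fun r => by
        change quaternionMap (algebraMap F A) rfl rfl rfl (e (algebraMap F H r)) = _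
        rw [Algebra.algebraMap_eq_smul_one (A := H) r, map_smul, map_one]
        ext <;> simp [quaternionMap, Algebra.algebraMap_eq_smul_one] }
  let f₂ : A →ₐ[F] ℍ[A, algebraMap F A a, algebraMap F A b, algebraMap F A c] :=
    (Algebra.ofId A _).restrictScalars F
  let g := Algebra.TensorProduct.lift f₁ f₂ fun x y => (QuaternionAlgebra.coe_commute y _).symm
  have hg : ∀ h y, g (h ⊗ₜ y) = quaternionMap (algebraMap F A) rfl rfl rfl (e h) *
      (y : ℍ[A, algebraMap F A a, algebraMap F A b, algebraMap F A c]) := fun h y =>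
    Algebra.TensorProduct.lift_tmul _ _ _ h y
  let e' : H ≃ₐ[F] ℍ[F,a,b,c] := AlgEquivClass.toAlgEquiv e
  -- The inverse of `g`, by the images of the basis `1, i, j, k`.
  let k : ℍ[A, algebraMap F A a, algebraMap F A b, algebraMap F A c] →+ H ⊗[F] A :=
    { toFun := fun q => e'.symm ⟨1, 0, 0, 0⟩ ⊗ₜ q.re + e'.symm ⟨0, 1, 0, 0⟩ ⊗ₜ q.imI +
        e'.symm ⟨0, 0, 1, 0⟩ ⊗ₜ q.imJ + e'.symm ⟨0, 0, 0, 1⟩ ⊗ₜ q.imK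
      map_zero' := by simp
      map_add' := fun x y => by
        simp only [QuaternionAlgebra.re_add, QuaternionAlgebra.imI_add, QuaternionAlgebra.imJ_add,
          QuaternionAlgebra.imK_add, TensorProduct.tmul_add]
        abel }
  have hgk : ∀ q, g (k q) = q := by
    intro q
    change g (_ + _ + _ + _) = q
    rw [map_add, map_add, map_add, hg, hg, hg, hg]
    have he : ∀ q, e (e'.symm q) = q := e'.apply_symm_apply
    rw [he, he, he, he]
    ext <;> simp [quaternionMap]
  have hkg : ∀ t, k (g t) = t := by
    intro t
    induction t with
    | zero => rw [map_zero, map_zero]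
    | add x y hx hy => rw [map_add, map_add, hx, hy]
    | tmul h y =>
      obtain ⟨q, rfl⟩ := e'.symm.surjective h
      rw [hg, show e (e'.symm q) = q from e'.apply_symm_apply q]
      have h1 : ∀ (r : F) (x : H), x ⊗ₜ[F] (algebraMap F A r * y) = (r • x) ⊗ₜ[F] y := fun r x => by
        rw [← Algebra.smul_def, TensorProduct.smul_tmul]
      have h2 : q = q.re • ⟨1, 0, 0, 0⟩ + q.imI • ⟨0, 1, 0, 0⟩ + q.imJ • ⟨0, 0, 1, 0⟩ +
          q.imK • ⟨0, 0, 0, 1⟩ := by ext <;> simp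
      conv_rhs => rw [h2, map_add, map_add, map_add, map_smul, map_smul, map_smul, map_smul,
        TensorProduct.add_tmul, TensorProduct.add_tmul, TensorProduct.add_tmul, ← h1, ← h1, ← h1,
        ← h1]
      change _ ⊗ₜ _ + _ ⊗ₜ _ + _ ⊗ₜ _ + _ ⊗ₜ _ = _
      simp [quaternionMap]
  exact ⟨(AlgEquiv.ofBijective g ⟨(show Function.LeftInverse k g from hkg).injective,
    (show Function.RightInverse k g from hgk).surjective⟩).toRingEquiv, hg⟩

lemma isStarStable_matrix_tensorProduct {a b c : F} {H : Type*} [Ring H] [Algebra F H]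
    [StarRing H] (e : H ≃⋆ₐ[F] ℍ[F,a,b,c]) (s : StarRing (H ⊗[F] A))
    (hs : ∀ (h : H) (y : A), s.star (h ⊗ₜ[F] y) = star h ⊗ₜ[F] y) {n : ℕ}
    (hA : IsStarStable (Matrix (Fin n) (Fin n)
      ℍ[A, algebraMap F A a, algebraMap F A b, algebraMap F A c])) :
    IsStarStable (Matrix (Fin n) (Fin n) (H ⊗[F] A)) := by
  obtain ⟨g, hg⟩ := exists_tensorProduct_ringEquiv (A := A) a b c e
  refine hA.matrix_of_ringEquiv g fun x => ?_
  induction x with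
  | zero => rw [star_zero, map_zero, star_zero]
  | add x y hx hy => rw [star_add, map_add, map_add, star_add, hx, hy]
  | tmul h y =>
    rw [hs, hg, hg, star_mul, QuaternionAlgebra.star_coe, map_star, quaternionMap_star,
      QuaternionAlgebra.coe_commutes]

end ExtendScalars

end StarBruhat

open StarBruhat TensorProduct in
theorem mainTheorem1 (n : ℕ) :
    -- (i) `*`-local rings
    (∀ (R : Type*) [Ring R] [StarRing R], IsStarLocalRing R →
      Subgroup.closure (bruhatElements (Matrix (Fin n) (Fin n) R)) =
        SLStar (Matrix (Fin n) (Fin n) R)) ∧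
    -- (ii) the adeles of a global field, with trivial involution
    (∀ (F : Type*) [Field F] [IsGlobalField F],
      letI : StarRing (AdeleRing F) := starRingOfComm
      Subgroup.closure (bruhatElements (Matrix (Fin n) (Fin n) (AdeleRing F))) =
        SLStar (Matrix (Fin n) (Fin n) (AdeleRing F))) ∧
    -- (iii) the adeles of a separable quadratic extension, with the Galois involution
    (∀ (F E : Type*) [Field F] [IsGlobalField F] [Field E] [Algebra F E]
      [Algebra.IsSeparable F E] (hE : Module.finrank F E = 2) (σ : E ≃ₐ[F] E), σ ≠ 1 →
      letI : StarRing (AdeleRing E) :=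
        galoisStarRing (σ : E ≃+* E) (apply_apply_of_finrank_eq_two hE σ)
      Subgroup.closure (bruhatElements (Matrix (Fin n) (Fin n) (AdeleRing E))) =
        SLStar (Matrix (Fin n) (Fin n) (AdeleRing E))) ∧
    -- (iv) the adelic quaternions in characteristic two
    (∀ (F H : Type*) [Field F] [IsGlobalField F] [CharP F 2] [Ring H] [Algebra F H] [StarRing H]
      (hH : IsQuaternionAlgebra F H),
      letI : StarRing (H ⊗[F] AdeleRing F) := adelicQuaternionStarRing hH
      Subgroup.closure (bruhatElements (Matrix (Fin n) (Fin n) (H ⊗[F] AdeleRing F))) =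
        SLStar (Matrix (Fin n) (Fin n) (H ⊗[F] AdeleRing F))) := by
  refine ⟨fun R _ _ hR => (hR.isStarStable n).closure_eq, fun F _ _ => ?_,
    fun F E _ _ _ _ _ hE σ _ => ?_, fun F H _ _ _ _ _ _ hH => ?_⟩
  · let : StarRing (AdeleRing F) := starRingOfComm
    exact (isStarStable_matrix_adeleRing_comm n).closure_eq
  · let : StarRing (AdeleRing E) := galoisStarRing (σ : E ≃+* E) (apply_apply_of_finrank_eq_two hE σ)
    exact (isStarStable_matrix_adeleRing (apply_apply_of_finrank_eq_two hE σ) n).closure_eq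
  · let : StarRing (H ⊗[F] AdeleRing F) := adelicQuaternionStarRing hH
    obtain ⟨a, b, c, hb, hc, ⟨e⟩⟩ := id hH
    -- In characteristic two, the discriminant `b² + 4 a` is `b²`.
    have hb' : b ≠ 0 := by
      rintro rfl
      have h2 : (2 : F) = 0 := CharP.cast_eq_zero F 2
      exact hb (by linear_combination 2 * a * h2)
    exact (isStarStable_matrix_tensorProduct e _ (adelicQuaternionStarRing_star_tmul hH)
      (isStarStable_matrix_quaternion_adeleRing a hb' hc n)).closure_eq
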